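/- A set partition of $[n]$ is represented by its restricted growth function $w_1\cdots w_n$ ($w_i=j$ if $i$ lies in the $j$-th block, blocks being ordered by their minima). A partition $\sigma$ contains a pattern $\pi$ if the word of $\sigma$ has a subsequence order-isomorphic to the word of $\pi$; otherwise it avoids $\pi$. Two sets of patterns $T,R$ are Wilf-equivalent, $T\sim R$, if for every $n\ge 1$ the number of partitions of $[n]$ avoiding all of $T$ equals the number avoiding all of $R$. A $(3,k)$-pair is a set $\{\sigma,\tau\}$, where $\sigma$ is a set partition of size $3$ with at least two blocks and $\tau$ is a set partition of size $k$ that avoids $\sigma$. A composition $b=(b_1,\dots,b_r)$ dominates a composition $a=(a_1,\dots,a_m)$ if there are $i(1)<\cdots<i(m)$ with $b_{i(j)}\ge a_j$ for all $j$. Compositions $a,a'$ are dominating equivalent, $a\overset{d}{\sim}a'$, if for every $n\ge1$ they are dominated by equally many compositions of $n$. Let $\xi_k$ be the number of dominating equivalence classes of compositions of $k$. An integer partition is $2$-free if no part equals $2$; the $2$-free partition associated to a composition is obtained by forgetting the order of the terms and replacing each term $2$ by two terms $1$. Let $p(n)$ be the number of integer partitions of $n$, with $p(n)=0$ for $n<0$.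 For $a=(a_1,\dots,a_m)$ put $\tau_{121}(a)=1^{a_1}2^{a_2}\cdots m^{a_m}$ and $\tau_{112}(a)=12\cdots m\,m^{a_m-1}\cdots 2^{a_2-1}1^{a_1-1}$. Then: 1. For every $k\ge 0$, $\xi_k=p(k)-p(k-2)$, and this is the number of $2$-free integer partitions of $k$. 2. For every $k\ge 2$, the $(3,k)$-pairs form exactly $p(k)-p(k-2)+1$ Wilf-equivalence classes. 3. (Answer to Problem 2.17 of Jelínek, Mansour and Shattuck.) For compositions $a,a'$ of positive integers, each of the statements $a\overset{d}{\sim}a'$ and $\{112,\tau_{112}(a)\}\sim\{112,\tau_{112}(a')\}$ holds if and only if $a$ and $a'$ have the same associated $2$-free partition. In particular, no two distinct $2$-free partitions of positive integers are dominating equivalent. 4. There are no Wilf-equivalences among $(3,k)$-pairs other than those described by Jelínek, Mansour and Shattuck: for $k\ge2$, two $(3,k)$-pairs $T,R$ are Wilf-equivalent if and only if $T=R$ or there is a $2$-free partition $P$ of $k$ such that both belong to the list of $P$. The list of $P$ consists of the pairs $\{121,\tau_{121}(a)\}$ and $\{112,\tau_{112}(a)\}$ for the compositions $a$ of $k$ with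 associated $2$-free partition $P$ and, if $P=(1,\dots,1)$, also of the pairs $\{122,\tau\}$ with $\tau$ of size $k$ avoiding $122$, and $\{123,\tau'\}$ with $\tau'\ne 1^k$ of size $k$ avoiding $123$. -/

import Mathlib

/-- The list `w = w₁ w₂ ⋯ wₙ` is a restricted growth function: every letter is positive and exceeds
the maximum of the preceding letters (`0` if there are none) by at most one. Restricted growth
functions of length `n` represent the set partitions of `[n]`: `i` lies in the `wᵢ`-th block, the
blocks being ordered by their minima. -/
def IsRGF (w : List ℕ) : Prop :=
  ∀ i : Fin w.length, 1 ≤ w.get i ∧ w.get i ≤ (w.take i).foldr max 0 + 1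

/-- The set partition `σ` contains the pattern `π`. -/
def ContainsPattern (σ π : List ℕ) : Prop :=
  ∃ h : Fin π.length → Fin σ.length, StrictMono h ∧ ∀ i j : Fin π.length,
    (σ.get (h i) = σ.get (h j) ↔ π.get i = π.get j) ∧
    (σ.get (h i) < σ.get (h j) ↔ π.get i < π.get j)

/-- `P_n(T)`: the set partitions of `[n]` that avoid all the patterns in `T`. -/
def avoiders (n : ℕ) (T : Set (List ℕ)) : Set (List ℕ) :=
  {w | IsRGF w ∧ w.length = n ∧ ∀ π ∈ T, ¬ ContainsPattern w π}

/-- Wilf-equivalence of two sets of patterns: `p_n(T) = p_n(R)` for all `n ≥ 1`. -/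
def WilfEquiv (T R : Set (List ℕ)) : Prop :=
  ∀ n : ℕ, 1 ≤ n → (avoiders n T).ncard = (avoiders n R).ncard

/-- The `(3,k)`-pairs `{σ, τ}`: `σ` is a set partition of size `3` with at least two blocks and `τ`
is a set partition of size `k` that avoids `σ`. -/
def threePairs (k : ℕ) : Set (Set (List ℕ)) :=
  {T | ∃ σ τ : List ℕ, IsRGF σ ∧ σ.length = 3 ∧ 2 ≤ σ.toFinset.card ∧
    IsRGF τ ∧ τ.length = k ∧ ¬ ContainsPattern τ σ ∧ T = {σ, τ}}

/-- Wilf-equivalence on the set of `(3,k)`-pairs. -/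
def wilfSetoid (k : ℕ) : Setoid (threePairs k) where
  r T R := WilfEquiv T.1 R.1
  iseqv := ⟨fun _ _ _ => rfl, fun h n hn => (h n hn).symm,
    fun h h' n hn => (h n hn).trans (h' n hn)⟩

/-- The number of Wilf-equivalence classes of `(3,k)`-pairs. -/
noncomputable def wilfClassCount (k : ℕ) : ℕ := Nat.card (Quotient (wilfSetoid k))

/-- The sequence `b` dominates the sequence `a`. -/
def Dominates (b a : List ℕ) : Prop :=
  ∃ i : Fin a.length → Fin b.length, StrictMono i ∧ ∀ j : Fin a.length, a.get j ≤ b.get (i j)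

/-- `D_n(a)`: the compositions of `n` that dominate the composition `a`. -/
def dominating (n : ℕ) {k : ℕ} (a : Composition k) : Set (Composition n) :=
  {b | Dominates b.blocks a.blocks}

/-- Dominating equivalence: `|D_n(a)| = |D_n(a')|` for all positive integers `n`. -/
def DomEquiv {k l : ℕ} (a : Composition k) (a' : Composition l) : Prop :=
  ∀ n : ℕ, 1 ≤ n → (dominating n a).ncard = (dominating n a').ncard

/-- Dominating equivalence on the set of compositions of `k`. -/
def domSetoid (k : ℕ) : Setoid (Composition k) where
  r a a' := DomEquiv a a'
  iseqv := ⟨fun _ _ _ => rfl, fun h n hn => (h n hn).symm,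
    fun h h' n hn => (h n hn).trans (h' n hn)⟩

/-- `ξ_k`: the number of dominating equivalence classes of compositions of `k`. -/
noncomputable def domClassCount (k : ℕ) : ℕ := Nat.card (Quotient (domSetoid k))

/-- The number `p(n)` of integer partitions of `n`, which is `0` for negative `n`. -/
def partitionNumber (n : ℤ) : ℤ :=
  if 0 ≤ n then (Fintype.card (Nat.Partition n.toNat) : ℤ) else 0

/-- An integer partition is `2`-free if no part equals `2`. -/
def IsTwoFree {k : ℕ} (P : Nat.Partition k) : Prop := 2 ∉ P.parts

/-- The `2`-free partition associated to a composition: forget the order of the terms and replace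
each term `2` by two terms `1`. -/
def twoFreePartition {k : ℕ} (a : Composition k) : Nat.Partition k where
  parts := (a.blocks : Multiset ℕ).bind fun x => if x = 2 then {1, 1} else {x}
  parts_pos := by
    intro i hi
    obtain ⟨x, hx, hi⟩ := Multiset.mem_bind.1 hi
    have hx0 := a.blocks_pos (Multiset.mem_coe.1 hx)
    split_ifs at hi with h
    · simp at hi
      omega
    · simp at hi
      omega
  parts_sum := by
    rw [Multiset.sum_bind]
    have h : (fun x : ℕ => (if x = 2 then ({1, 1} : Multiset ℕ) else {x}).sum) = id := by
      funext x
      split_ifs with h <;> simp [h]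
    rw [h, Multiset.map_id, Multiset.sum_coe, a.blocks_sum]

/-- `1^{a₁} 2^{a₂} ⋯ m^{a_m}`. -/
def tau121 (a : List ℕ) : List ℕ :=
  (a.mapIdx fun i x => List.replicate x (i + 1)).flatten

/-- `1 2 ⋯ m m^{a_m - 1} ⋯ 2^{a₂ - 1} 1^{a₁ - 1}`. -/
def tau112 (a : List ℕ) : List ℕ :=
  List.range' 1 a.length ++ (a.mapIdx fun i x => List.replicate (x - 1) (i + 1)).reverse.flatten

/-- The set of `(3,k)`-pairs that belongs to a `2`-free partition `P` of `k` in the description of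
Jelínek, Mansour and Shattuck: the pairs `{121, τ₁₂₁(a)}` and `{112, τ₁₁₂(a)}` for the compositions
`a` whose associated `2`-free partition is `P`, and, if all parts of `P` are `1`, also the pairs
`{122, τ}` with `τ` avoiding `122` and `{123, τ'}` with `τ' ≠ 1^k` avoiding `123`. -/
def describedClass {k : ℕ} (P : Nat.Partition k) : Set (Set (List ℕ)) :=
  {T | (∃ a : Composition k, twoFreePartition a = P ∧
          (T = {[1, 2, 1], tau121 a.blocks} ∨ T = {[1, 1, 2], tau112 a.blocks})) ∨
       ((∀ x ∈ P.parts, x = 1) ∧ ∃ τ : List ℕ, IsRGF τ ∧ τ.length = k ∧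
          ((¬ ContainsPattern τ [1, 2, 2] ∧ T = {[1, 2, 2], τ}) ∨
           (¬ ContainsPattern τ [1, 2, 3] ∧ τ ≠ List.replicate k 1 ∧ T = {[1, 2, 3], τ})))}

/-!
Every family of avoiders in question is a family of compositions of `n`, or of binary words of
length `n - 1`, and containment becomes a subword order there.

A restricted growth function avoids `121` if and only if it is weakly increasing, and avoids `112`
if and only if it is `1 2 ⋯ m` followed by a weakly decreasing word. Both kinds of words are
determined by the multiplicities of their letters, which form a composition `b` of `n`; they are
`tau121 b` and `tau112 b`. Containment of `tau121 a`, or of `tau112 a`, is domination of `a`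
(`containsPattern_tau121_iff`, `containsPattern_tau112_iff`), so that `2 ^ (n - 1) - |D_n(a)|`
partitions avoid such a pair. The avoiders of `122`, and those of `123`, correspond to binary words
recording which letters equal `1`, and containment becomes the subword order (`onesCode`), except
for the pattern `1^k` and `σ = 123`. The number of binary words that contain a given word depends
only on its length; it is the number of compositions dominating `(1, …, 1)`
(`superwordCount_eq_dominatingCount`). The pair `{123, 1^k}` has no long avoiders at all, hence
forms a class of its own.

It remains to classify compositions up to dominating equivalence. Greedy matching shows that the
generating function of the compositions dominating `a = (a₁, …, a_m)` is
`X^(a₁ + ⋯ + a_m) * D / ∏ (1 - 2X + X^(a_j))`, where `D` is the generating function of all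
compositions (`domDenominator_mul_dominatingSeries`). Since `1 - 2X + X^2 = (1 - X)^2`, a part `2`
may be replaced by two parts `1`, and the order of the parts is irrelevant. Conversely, for `y ≥ 3`
the polynomial `1 - 2X + X^y` has a root in `(0, 1)`, and such a root determines `y`; hence the
product determines the parts `y ≥ 3`, and the sum then determines the number of parts `1`
(`eq_of_domDenominator_eq`).
-/

/-! ### Domination of compositions and its generating function -/

/-- Domination is the relation `List.SublistForall₂ (· ≤ ·)`, which is defined by recursion. -/
theorem dominates_iff_sublistForall₂ {a b : List ℕ} :
    Dominates b a ↔ List.SublistForall₂ (· ≤ ·) a b := by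
  rw [List.sublistForall₂_iff]
  constructor
  · rintro ⟨i, hi, h⟩
    refine ⟨List.ofFn fun j => b.get (i j), ?_, ?_⟩
    · rw [List.forall₂_iff_get]
      refine ⟨by simp, fun j hj _ => ?_⟩
      simpa using h ⟨j, hj⟩
    · rw [List.sublist_iff_exists_fin_orderEmbedding_get_eq]
      refine ⟨(Fin.castOrderIso (by simp)).toOrderEmbedding.trans
        (OrderEmbedding.ofStrictMono i hi), fun j => ?_⟩
      simp
      rfl
  · rintro ⟨l, hal, hlb⟩
    obtain ⟨f, hf⟩ := List.sublist_iff_exists_fin_orderEmbedding_get_eq.1 hlb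
    obtain ⟨hlen, hle⟩ := List.forall₂_iff_get.1 hal
    refine ⟨fun j => f (Fin.cast hlen j), fun x y hxy => f.strictMono (by simpa using hxy),
      fun j => ?_⟩
    rw [← hf]
    exact hle j j.2 (hlen ▸ j.2)

theorem List.SublistForall₂.of_cons_left {α β : Type*} {R : α → β → Prop} {x : α} {a : List α}
    {b : List β} (h : List.SublistForall₂ R (x :: a) b) : List.SublistForall₂ R a b := by
  induction b with
  | nil => cases h
  | cons y b ih =>
    cases h with
    | cons _ h => exact h.cons_right
    | cons_right h => exact (ih h).cons_right

/-- Greedy matching: an initial term that is large enough may be matched at once. -/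
theorem sublistForall₂_le_cons_cons {x y : ℕ} {a b : List ℕ} :
    List.SublistForall₂ (· ≤ ·) (y :: a) (x :: b) ↔
      List.SublistForall₂ (· ≤ ·) (if y ≤ x then a else y :: a) b := by
  split_ifs with hxy
  · constructor
    · rintro (_ | ⟨_, h⟩ | h)
      · exact h
      · exact h.of_cons_left
    · exact fun h => .cons hxy h
  · constructor
    · rintro (_ | ⟨h, _⟩ | h)
      · exact absurd h hxy
      · exact h
    · exact fun h => h.cons_right

/-- The compositions of `n`, as lists. -/
def compositionLists (n : ℕ) : Finset (List ℕ) :=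
  (Finset.univ : Finset (Composition n)).image Composition.blocks

theorem mem_compositionLists {n : ℕ} {b : List ℕ} :
    b ∈ compositionLists n ↔ (∀ x ∈ b, 0 < x) ∧ b.sum = n := by
  simp only [compositionLists, Finset.mem_image, Finset.mem_univ, true_and]
  constructor
  · rintro ⟨c, rfl⟩
    exact ⟨fun x hx => c.blocks_pos hx, c.blocks_sum⟩
  · rintro ⟨h, rfl⟩
    exact ⟨⟨b, fun hx => h _ hx, rfl⟩, rfl⟩

theorem card_compositionLists (n : ℕ) : (compositionLists n).card = 2 ^ (n - 1) := by
  rw [compositionLists, Finset.card_image_of_injective _ fun _ _ h => Composition.ext h,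
    Finset.card_univ, composition_card]

open scoped Classical in
/-- The compositions of `n` that dominate `a`, as lists. -/
noncomputable def dominatingLists (a : List ℕ) (n : ℕ) : Finset (List ℕ) :=
  (compositionLists n).filter fun b => List.SublistForall₂ (· ≤ ·) a b

theorem mem_dominatingLists {a b : List ℕ} {n : ℕ} :
    b ∈ dominatingLists a n ↔
      ((∀ x ∈ b, 0 < x) ∧ b.sum = n) ∧ List.SublistForall₂ (· ≤ ·) a b := by
  classical
  rw [dominatingLists, Finset.mem_filter, mem_compositionLists]

theorem dominatingLists_nil (n : ℕ) : dominatingLists [] n = compositionLists n := by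
  classical
  exact Finset.filter_true_of_mem fun _ _ => .nil

/-- The number of compositions of `n` that dominate `a`. -/
noncomputable def dominatingCount (a : List ℕ) (n : ℕ) : ℕ := (dominatingLists a n).card

theorem ncard_dominating (n : ℕ) {k : ℕ} (a : Composition k) :
    (dominating n a).ncard = dominatingCount a.blocks n := by
  rw [dominatingCount, ← Set.ncard_coe_finset,
    ← Set.ncard_image_of_injective (dominating n a) (fun _ _ h => Composition.ext h)]
  congr 1
  ext b
  simp only [dominating, dominates_iff_sublistForall₂, Set.mem_image, Set.mem_ofPred_eq,
    Finset.mem_coe, mem_dominatingLists]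
  constructor
  · rintro ⟨c, hc, rfl⟩
    exact ⟨⟨fun x hx => c.blocks_pos hx, c.blocks_sum⟩, hc⟩
  · rintro ⟨⟨h, rfl⟩, hb⟩
    exact ⟨⟨b, fun hx => h _ hx, rfl⟩, hb, rfl⟩

theorem domEquiv_iff {k l : ℕ} (a : Composition k) (a' : Composition l) :
    DomEquiv a a' ↔ ∀ n, 1 ≤ n → dominatingCount a.blocks n = dominatingCount a'.blocks n := by
  simp only [DomEquiv, ncard_dominating]

/-- Sorting the dominating compositions by their first term `p.1`. -/
theorem dominatingCount_cons (y : ℕ) (a : List ℕ) (n : ℕ) :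
    dominatingCount (y :: a) n = ∑ p ∈ Finset.HasAntidiagonal.antidiagonal n,
      if 1 ≤ p.1 then dominatingCount (if y ≤ p.1 then a else y :: a) p.2 else 0 := by
  have key : dominatingLists (y :: a) n = (Finset.HasAntidiagonal.antidiagonal n).biUnion fun p =>
      (if 1 ≤ p.1 then dominatingLists (if y ≤ p.1 then a else y :: a) p.2 else ∅).image
        (List.cons p.1) := by
    ext b
    simp only [mem_dominatingLists, Finset.mem_biUnion, Finset.mem_image,
      Finset.HasAntidiagonal.mem_antidiagonal, Prod.exists]
    constructor
    · rintro ⟨⟨hpos, hsum⟩, h⟩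
      cases b with
      | nil => cases h
      | cons x b =>
        refine ⟨x, b.sum, by simpa using hsum, b, ?_, rfl⟩
        rw [if_pos (show 1 ≤ x from hpos x (by simp)), mem_dominatingLists]
        exact ⟨⟨fun z hz => hpos z (by simp [hz]), rfl⟩, sublistForall₂_le_cons_cons.1 h⟩
    · rintro ⟨x, s, hxs, b, hb, rfl⟩
      split_ifs at hb with hx hyx
      · rw [mem_dominatingLists] at hb
        refine ⟨⟨by simpa using ⟨hx, hb.1.1⟩, by simp [hb.1.2, hxs]⟩, ?_⟩
        rw [sublistForall₂_le_cons_cons, if_pos hyx]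
        exact hb.2
      · rw [mem_dominatingLists] at hb
        refine ⟨⟨by simpa using ⟨hx, hb.1.1⟩, by simp [hb.1.2, hxs]⟩, ?_⟩
        rw [sublistForall₂_le_cons_cons, if_neg hyx]
        exact hb.2
      · simp at hb
  rw [dominatingCount, key, Finset.card_biUnion]
  · refine Finset.sum_congr rfl fun p _ => ?_
    rw [Finset.card_image_of_injective _ (List.cons_injective)]
    split_ifs <;> simp [dominatingCount]
  · intro p hp q hq hpq
    rw [Function.onFun, Finset.disjoint_left]
    intro b hb hb'
    obtain ⟨c, -, rfl⟩ := Finset.mem_image.1 hb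
    obtain ⟨d, -, h⟩ := Finset.mem_image.1 hb'
    simp only [Finset.mem_coe, Finset.HasAntidiagonal.mem_antidiagonal] at hp hq
    have h1 : q.1 = p.1 := (List.cons.inj h).1
    exact hpq (Prod.ext h1.symm (by omega))

open PowerSeries in
/-- The generating function of the compositions that dominate `a`. -/
noncomputable def dominatingSeries (a : List ℕ) : PowerSeries ℝ :=
  PowerSeries.mk fun n => (dominatingCount a n : ℝ)

open PowerSeries in
theorem mk_indicator_le_mul_one_sub_X {y : ℕ} (hy : 1 ≤ y) :
    (PowerSeries.mk fun n => if y ≤ n then (1 : ℝ) else 0) * (1 - X) = X ^ y := by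
  ext n
  rw [mul_sub, mul_one, map_sub, coeff_mk, coeff_X_pow]
  cases n with
  | zero =>
    simp only [coeff_zero_mul_X]
    split_ifs <;> first | omega | simp
  | succ n =>
    rw [coeff_succ_mul_X, coeff_mk]
    split_ifs <;> first | omega | simp

open PowerSeries in
theorem dominatingSeries_cons {y : ℕ} (hy : 1 ≤ y) (a : List ℕ) :
    (1 - 2 * X + X ^ y) * dominatingSeries (y :: a) = X ^ y * dominatingSeries a := by
  set U : ℕ → PowerSeries ℝ := fun y => PowerSeries.mk fun n => if y ≤ n then (1 : ℝ) else 0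
  have h : dominatingSeries (y :: a) =
      U y * dominatingSeries a + (U 1 - U y) * dominatingSeries (y :: a) := by
    ext n
    rw [map_add, coeff_mul, coeff_mul, ← Finset.sum_add_distrib]
    simp only [U, dominatingSeries, coeff_mk, map_sub]
    rw [dominatingCount_cons, Nat.cast_sum]
    refine Finset.sum_congr rfl fun p _ => ?_
    by_cases h1 : 1 ≤ p.1 <;> by_cases h2 : y ≤ p.1
    · simp [h1, h2]
    · simp [h1, h2]
    · omega
    · simp [h1, h2]
  have h1 := mk_indicator_le_mul_one_sub_X le_rfl
  have hy := mk_indicator_le_mul_one_sub_X hy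
  rw [pow_one] at h1
  linear_combination (1 - X) * h + (dominatingSeries a - dominatingSeries (y :: a)) * hy +
    dominatingSeries (y :: a) * h1

/-- The product of the polynomials `1 - 2X + X^y` over the parts `y`: the denominator of the
generating function. -/
noncomputable def domDenominator (M : Multiset ℕ) : Polynomial ℝ :=
  (M.map fun y => 1 - 2 * Polynomial.X + Polynomial.X ^ y).prod

open PowerSeries in
theorem domDenominator_mul_dominatingSeries {a : List ℕ} (ha : ∀ y ∈ a, 0 < y) :
    (domDenominator a : PowerSeries ℝ) * dominatingSeries a =
      X ^ a.sum * dominatingSeries [] := by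
  induction a with
  | nil => simp [domDenominator]
  | cons y a ih =>
    have h1 := dominatingSeries_cons (ha y (by simp)) a
    have h2 := ih fun z hz => ha z (by simp [hz])
    have h3 : (domDenominator ((y :: a : List ℕ) : Multiset ℕ) : PowerSeries ℝ) =
        (1 - 2 * X + X ^ y) * (domDenominator (a : Multiset ℕ) : PowerSeries ℝ) := by
      have h2c : ((2 : Polynomial ℝ) : PowerSeries ℝ) = 2 :=
        map_ofNat (Polynomial.coeToPowerSeries.ringHom (R := ℝ)) 2
      simp [domDenominator, h2c]
    rw [h3, List.sum_cons, pow_add]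
    linear_combination (domDenominator (a : Multiset ℕ) : PowerSeries ℝ) * h1 + X ^ y * h2

/-! ### Dominating equivalence and 2-free partitions -/

theorem domDenominator_add (M N : Multiset ℕ) :
    domDenominator (M + N) = domDenominator M * domDenominator N := by
  simp [domDenominator]

theorem eval_domDenominator_eq_zero {M : Multiset ℕ} {r : ℝ} :
    (domDenominator M).eval r = 0 ↔ ∃ y ∈ M, 1 - 2 * r + r ^ y = 0 := by
  rw [domDenominator, Polynomial.eval_multiset_prod, Multiset.prod_eq_zero_iff]
  simp

theorem domDenominator_coeff_zero {M : Multiset ℕ} (hM : ∀ y ∈ M, 0 < y) :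
    (domDenominator M).coeff 0 = 1 := by
  rw [Polynomial.coeff_zero_eq_eval_zero, domDenominator, Polynomial.eval_multiset_prod,
    Multiset.map_map]
  refine Multiset.prod_eq_one fun x hx => ?_
  obtain ⟨y, hy, rfl⟩ := Multiset.mem_map.1 hx
  simp [(hM y hy).ne']

theorem domDenominator_ne_zero {M : Multiset ℕ} (hM : ∀ y ∈ M, 0 < y) :
    domDenominator M ≠ 0 := by
  intro h
  simpa [h] using domDenominator_coeff_zero hM

theorem twoFreePartition_parts {k : ℕ} (a : Composition k) :
    (twoFreePartition a).parts =
      (a.blocks : Multiset ℕ).bind fun x => if x = 2 then {1, 1} else {x} := rfl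

/-- Replacing a part `2` by two parts `1` leaves the denominator unchanged, because
`1 - 2X + X^2 = (1 - X)^2`. -/
theorem domDenominator_twoFreePartition {k : ℕ} (a : Composition k) :
    domDenominator (twoFreePartition a).parts = domDenominator a.blocks := by
  have h : ∀ M : Multiset ℕ, domDenominator (M.bind fun x => if x = 2 then {1, 1} else {x}) =
      domDenominator M := by
    intro M
    induction M using Multiset.induction with
    | empty => simp
    | cons x M ih =>
      rw [Multiset.cons_bind, domDenominator_add, ih, ← Multiset.singleton_add,
        domDenominator_add]
      congr 1
      split_ifs with hx
      · subst hx
        simp only [domDenominator, Multiset.insert_eq_cons, Multiset.map_cons,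
          Multiset.map_singleton, Multiset.prod_cons, Multiset.prod_singleton]
        ring
      · rfl
  rw [twoFreePartition_parts, h]

theorem isTwoFree_twoFreePartition {k : ℕ} (a : Composition k) :
    IsTwoFree (twoFreePartition a) := by
  intro h
  rw [twoFreePartition_parts] at h
  obtain ⟨x, -, hx⟩ := Multiset.mem_bind.1 h
  split_ifs at hx with h2
  · simp at hx
  · exact h2 (Multiset.mem_singleton.1 hx).symm

/-- For `y ≥ 3` the polynomial `1 - 2X + X^y` has a root strictly between `0` and `1`. -/
theorem exists_root_of_three_le {y : ℕ} (hy : 3 ≤ y) :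
    ∃ r : ℝ, 0 < r ∧ r < 1 ∧ 1 - 2 * r + r ^ y = 0 := by
  have hc : ContinuousOn (fun r : ℝ => 1 - 2 * r + r ^ y) (Set.Icc (1 / 2) (9 / 10)) := by
    fun_prop
  have h9 : (1 : ℝ) - 2 * (9 / 10) + (9 / 10) ^ y ≤ 0 := by
    have := pow_le_pow_of_le_one (show (0 : ℝ) ≤ 9 / 10 by norm_num) (by norm_num) hy
    norm_num at this ⊢
    linarith
  have h5 : (0 : ℝ) ≤ 1 - 2 * (1 / 2) + (1 / 2) ^ y := by
    have : (0 : ℝ) < (1 / 2) ^ y := by positivity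
    linarith
  obtain ⟨r, ⟨hr1, hr2⟩, hr⟩ :=
    intermediate_value_Icc' (show (1 / 2 : ℝ) ≤ 9 / 10 by norm_num) hc ⟨h9, h5⟩
  exact ⟨r, by linarith, by linarith, hr⟩

/-- A part `y ≥ 3` is determined by any root of `1 - 2X + X^y` between `0` and `1`. -/
theorem eq_of_common_root {y z : ℕ} {r : ℝ} (h0 : 0 < r) (h1 : r < 1)
    (hy : 1 - 2 * r + r ^ y = 0) (hz : 1 - 2 * r + r ^ z = 0) : y = z :=
  pow_right_injective₀ h0 h1.ne (show r ^ y = r ^ z by linarith)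

/-- A multiset of positive integers without `2` is determined by its sum and its denominator. -/
theorem eq_of_domDenominator_eq {M N : Multiset ℕ} (hM : ∀ y ∈ M, 0 < y) (hN : ∀ y ∈ N, 0 < y)
    (hM2 : 2 ∉ M) (hN2 : 2 ∉ N) (hsum : M.sum = N.sum)
    (h : domDenominator M = domDenominator N) : M = N := by
  -- after removing the common parts, no part `y ≥ 3` is left, since its root would be shared
  have hMI : M - N + M ∩ N = M := Multiset.sub_add_inter M N
  have hNI : N - M + M ∩ N = N := by rw [Multiset.inter_comm]; exact Multiset.sub_add_inter N M
  have hI : ∀ y ∈ M ∩ N, 0 < y := fun y hy => hM y (Multiset.mem_inter.1 hy).1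
  have hdiff : domDenominator (M - N) = domDenominator (N - M) := by
    refine mul_right_cancel₀ (domDenominator_ne_zero hI) ?_
    rw [← domDenominator_add, ← domDenominator_add, hMI, hNI, h]
  have hs : (M - N).sum = (N - M).sum := by
    have h1 := congrArg Multiset.sum hMI
    have h2 := congrArg Multiset.sum hNI
    rw [Multiset.sum_add] at h1 h2
    omega
  have ones : ∀ A B : Multiset ℕ, (∀ y ∈ A, 0 < y) → 2 ∉ A →
      domDenominator (A - B) = domDenominator (B - A) → ∀ y ∈ A - B, y = 1 := by
    intro A B hA hA2 hAB y hy
    have hyA : y ∈ A := Multiset.mem_of_le (Multiset.sub_le_self A B) hy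
    have hy0 := hA y hyA
    have hy2 : y ≠ 2 := fun h => hA2 (h ▸ hyA)
    by_contra hy1
    obtain ⟨r, h0, h1, hr⟩ := exists_root_of_three_le (show 3 ≤ y by omega)
    have hev := eval_domDenominator_eq_zero.2 ⟨y, hy, hr⟩
    rw [hAB] at hev
    obtain ⟨z, hz, hrz⟩ := eval_domDenominator_eq_zero.1 hev
    obtain rfl := eq_of_common_root h0 h1 hr hrz
    rw [← Multiset.count_pos, Multiset.count_sub] at hy hz
    omega
  have hMr := Multiset.eq_replicate_card.2 (ones M N hM hM2 hdiff)
  have hNr := Multiset.eq_replicate_card.2 (ones N M hN hN2 hdiff.symm)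
  have hcard : (M - N).card = (N - M).card := by
    rw [hMr, hNr] at hs
    simpa using hs
  calc M = M - N + M ∩ N := hMI.symm
    _ = N - M + M ∩ N := by rw [hMr, hNr, hcard]
    _ = N := hNI

theorem constantCoeff_dominatingSeries_nil :
    PowerSeries.constantCoeff (dominatingSeries []) = 1 := by
  rw [← PowerSeries.coeff_zero_eq_constantCoeff_apply, dominatingSeries, PowerSeries.coeff_mk,
    dominatingCount, dominatingLists_nil, card_compositionLists]
  simp

theorem dominatingCount_self_pos {a : List ℕ} (ha : ∀ x ∈ a, 0 < x) :
    0 < dominatingCount a a.sum := by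
  refine Finset.card_pos.2 ⟨a, mem_dominatingLists.2 ⟨⟨ha, rfl⟩, ?_⟩⟩
  rw [List.sublistForall₂_iff]
  exact ⟨a, List.forall₂_same.2 fun _ _ => le_rfl, List.Sublist.refl _⟩

theorem dominatingCount_eq_zero {a : List ℕ} {n : ℕ} (h : n < a.sum) :
    dominatingCount a n = 0 := by
  refine Finset.card_eq_zero.2 (Finset.eq_empty_of_forall_notMem fun b hb => ?_)
  obtain ⟨⟨-, rfl⟩, hab⟩ := mem_dominatingLists.1 hb
  obtain ⟨l, hal, hlb⟩ := List.sublistForall₂_iff.1 hab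
  have h1 : a.sum ≤ l.sum := hal.sum_le_sum
  have h2 : l.sum ≤ b.sum := hlb.sum_le_sum (fun _ _ => Nat.zero_le _)
  omega

theorem dominatingCount_eq_iff {k l : ℕ} (a : Composition k) (a' : Composition l) :
    (∀ n, dominatingCount a.blocks n = dominatingCount a'.blocks n) ↔
      (twoFreePartition a).parts = (twoFreePartition a').parts := by
  have hpos : ∀ {m : ℕ} (c : Composition m), ∀ y ∈ c.blocks, 0 < y := fun c y hy => c.blocks_pos hy
  have hser := domDenominator_mul_dominatingSeries (hpos a)
  have hser' := domDenominator_mul_dominatingSeries (hpos a')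
  rw [← domDenominator_twoFreePartition, a.blocks_sum] at hser
  rw [← domDenominator_twoFreePartition, a'.blocks_sum] at hser'
  have hne : ∀ {m : ℕ} (P : Nat.Partition m), (domDenominator P.parts : PowerSeries ℝ) ≠ 0 := by
    intro m P h
    exact domDenominator_ne_zero (fun y hy => P.parts_pos hy) (Polynomial.coe_eq_zero_iff.1 h)
  have hnil : dominatingSeries [] ≠ 0 := fun h => by
    simpa [h] using constantCoeff_dominatingSeries_nil
  constructor
  · intro h
    have hkl : k = l := by
      have h1 := dominatingCount_self_pos (hpos a)
      have h2 := dominatingCount_self_pos (hpos a')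
      rw [a.blocks_sum] at h1
      rw [a'.blocks_sum] at h2
      by_contra hkl
      rcases Nat.lt_or_gt_of_ne hkl with hlt | hlt
      · rw [h, dominatingCount_eq_zero (by rwa [a'.blocks_sum])] at h1
        exact h1.false
      · rw [← h, dominatingCount_eq_zero (by rwa [a.blocks_sum])] at h2
        exact h2.false
    subst hkl
    have hS : dominatingSeries a.blocks = dominatingSeries a'.blocks := by
      simp only [dominatingSeries, h]
    have hS0 : dominatingSeries a'.blocks ≠ 0 := by
      intro h0
      rw [h0, mul_zero] at hser'
      exact mul_ne_zero (pow_ne_zero _ PowerSeries.X_ne_zero) hnil hser'.symm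
    refine eq_of_domDenominator_eq (fun y hy => (twoFreePartition a).parts_pos hy)
      (fun y hy => (twoFreePartition a').parts_pos hy) (isTwoFree_twoFreePartition a)
      (isTwoFree_twoFreePartition a')
      ((twoFreePartition a).parts_sum.trans (twoFreePartition a').parts_sum.symm) ?_
    refine Polynomial.coe_injective ℝ (mul_right_cancel₀ hS0 ?_)
    rw [hser', ← hser, hS]
  · intro h n
    have hkl : k = l := by
      rw [← (twoFreePartition a).parts_sum, h, (twoFreePartition a').parts_sum]
    subst hkl
    have hS : dominatingSeries a.blocks = dominatingSeries a'.blocks := by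
      refine mul_left_cancel₀ (hne (twoFreePartition a)) ?_
      rw [hser, h, hser']
    have := congrArg (PowerSeries.coeff n) hS
    simpa [dominatingSeries] using this

theorem domEquiv_iff_twoFreePartition {k l : ℕ} (hk : 1 ≤ k) (hl : 1 ≤ l) (a : Composition k)
    (a' : Composition l) :
    DomEquiv a a' ↔ (twoFreePartition a).parts = (twoFreePartition a').parts := by
  rw [domEquiv_iff, ← dominatingCount_eq_iff]
  refine ⟨fun h n => ?_, fun h n _ => h n⟩
  rcases Nat.eq_zero_or_pos n with rfl | hn
  · rw [dominatingCount_eq_zero (by rwa [a.blocks_sum]),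
      dominatingCount_eq_zero (by rwa [a'.blocks_sum])]
  · exact h n hn

/-- Every `2`-free partition is associated to a composition: list its parts in any order. -/
theorem exists_twoFreePartition_eq {k : ℕ} {P : Nat.Partition k} (hP : IsTwoFree P) :
    ∃ a : Composition k, twoFreePartition a = P := by
  refine ⟨⟨P.parts.toList, fun hi => P.parts_pos (Multiset.mem_toList.1 hi), ?_⟩, ?_⟩
  · rw [Multiset.sum_toList, P.parts_sum]
  · refine Nat.Partition.ext ?_
    simp only [twoFreePartition, Multiset.coe_toList]
    rw [Multiset.bind_congr (g := fun x => {x}), Multiset.bind_singleton, Multiset.map_id']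
    intro x hx
    rw [if_neg]
    rintro rfl
    exact hP hx

/-! ### Pattern containment and restricted growth functions -/

/-- Containment by words: some strictly increasing renaming of the letters of the pattern is a
subword. -/
theorem containsPattern_iff {w p : List ℕ} :
    ContainsPattern w p ↔
      ∃ f : ℕ → ℕ, StrictMonoOn f {x | x ∈ p} ∧ (p.map f).Sublist w := by
  classical
  constructor
  · rintro ⟨h, hmono, hrel⟩
    have hex : ∀ i : Fin p.length, ∃ j : Fin p.length, p.get j = p.get i := fun i => ⟨i, rfl⟩
    let f : ℕ → ℕ := fun x =>
      if hx : ∃ j : Fin p.length, p.get j = x then w.get (h hx.choose) else 0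
    have hf : ∀ i, f (p.get i) = w.get (h i) := by
      intro i
      simp only [f]
      rw [dif_pos (hex i)]
      exact (hrel _ _).1.2 (hex i).choose_spec
    refine ⟨f, ?_, ?_⟩
    · intro x hx y hy hxy
      obtain ⟨i, rfl⟩ := List.get_of_mem hx
      obtain ⟨j, rfl⟩ := List.get_of_mem hy
      rw [hf, hf]
      exact (hrel i j).2.2 hxy
    · rw [List.sublist_iff_exists_fin_orderEmbedding_get_eq]
      refine ⟨(Fin.castOrderIso (by simp)).toOrderEmbedding.trans
        (OrderEmbedding.ofStrictMono h hmono), fun j => ?_⟩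
      have := hf (Fin.cast (by simp) j)
      simpa using this
  · rintro ⟨f, hf, hsub⟩
    obtain ⟨e, he⟩ := List.sublist_iff_exists_fin_orderEmbedding_get_eq.1 hsub
    have hget : ∀ j : Fin p.length,
        w.get (e (Fin.cast (List.length_map f).symm j)) = f (p.get j) := by
      intro j
      rw [← he]
      simp
    refine ⟨fun j => e (Fin.cast (List.length_map f).symm j),
      fun x y hxy => e.strictMono (by simpa using hxy), fun i j => ?_⟩
    rw [hget, hget]
    exact ⟨hf.injOn.eq_iff (List.get_mem _ _) (List.get_mem _ _),
      hf.lt_iff_lt (List.get_mem _ _) (List.get_mem _ _)⟩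

theorem containsPattern_121_iff {w : List ℕ} :
    ContainsPattern w [1, 2, 1] ↔ ∃ x y, x < y ∧ [x, y, x].Sublist w := by
  rw [containsPattern_iff]
  constructor
  · rintro ⟨f, hf, h⟩
    exact ⟨f 1, f 2, hf (by simp) (by simp) (by norm_num), h⟩
  · rintro ⟨x, y, hxy, h⟩
    refine ⟨fun n => if n = 1 then x else y, ?_, by simpa using h⟩
    intro a ha b hb hab
    simp only [Set.mem_ofPred_eq, List.mem_cons, List.not_mem_nil, or_false] at ha hb
    obtain ⟨rfl, rfl⟩ : a = 1 ∧ b = 2 := by omega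
    simpa using hxy

theorem containsPattern_112_iff {w : List ℕ} :
    ContainsPattern w [1, 1, 2] ↔ ∃ x y, x < y ∧ [x, x, y].Sublist w := by
  rw [containsPattern_iff]
  constructor
  · rintro ⟨f, hf, h⟩
    exact ⟨f 1, f 2, hf (by simp) (by simp) (by norm_num), h⟩
  · rintro ⟨x, y, hxy, h⟩
    refine ⟨fun n => if n = 1 then x else y, ?_, by simpa using h⟩
    intro a ha b hb hab
    simp only [Set.mem_ofPred_eq, List.mem_cons, List.not_mem_nil, or_false] at ha hb
    obtain ⟨rfl, rfl⟩ : a = 1 ∧ b = 2 := by omega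
    simpa using hxy

theorem containsPattern_122_iff {w : List ℕ} :
    ContainsPattern w [1, 2, 2] ↔ ∃ x y, x < y ∧ [x, y, y].Sublist w := by
  rw [containsPattern_iff]
  constructor
  · rintro ⟨f, hf, h⟩
    exact ⟨f 1, f 2, hf (by simp) (by simp) (by norm_num), h⟩
  · rintro ⟨x, y, hxy, h⟩
    refine ⟨fun n => if n = 1 then x else y, ?_, by simpa using h⟩
    intro a ha b hb hab
    simp only [Set.mem_ofPred_eq, List.mem_cons, List.not_mem_nil, or_false] at ha hb
    obtain ⟨rfl, rfl⟩ : a = 1 ∧ b = 2 := by omega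
    simpa using hxy

theorem containsPattern_123_iff {w : List ℕ} :
    ContainsPattern w [1, 2, 3] ↔ ∃ x y z, x < y ∧ y < z ∧ [x, y, z].Sublist w := by
  rw [containsPattern_iff]
  constructor
  · rintro ⟨f, hf, h⟩
    exact ⟨f 1, f 2, f 3, hf (by simp) (by simp) (by norm_num),
      hf (by simp) (by simp) (by norm_num), h⟩
  · rintro ⟨x, y, z, hxy, hyz, h⟩
    refine ⟨fun n => if n = 1 then x else if n = 2 then y else z, ?_, by simpa using h⟩
    intro a ha b hb hab
    simp only [Set.mem_ofPred_eq, List.mem_cons, List.not_mem_nil, or_false] at ha hb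
    obtain ⟨rfl, rfl⟩ | ⟨rfl, rfl⟩ | ⟨rfl, rfl⟩ :
      (a = 1 ∧ b = 2) ∨ (a = 1 ∧ b = 3) ∨ (a = 2 ∧ b = 3) := by omega
    · simpa using hxy
    · simpa using hxy.trans hyz
    · simpa using hyz

theorem foldr_max_zero_spec (u : List ℕ) :
    (∀ x ∈ u, x ≤ u.foldr max 0) ∧ (u.foldr max 0 = 0 ∨ u.foldr max 0 ∈ u) := by
  induction u with
  | nil => simp
  | cons a u ih =>
    simp only [List.foldr_cons, List.mem_cons]
    refine ⟨?_, ?_⟩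
    · rintro x (rfl | hx)
      · exact le_max_left _ _
      · exact (ih.1 x hx).trans (le_max_right _ _)
    · rcases le_total a (u.foldr max 0) with h | h
      · rw [max_eq_right h]
        exact ih.2.imp id Or.inr
      · rw [max_eq_left h]
        exact Or.inr (Or.inl rfl)

/-- In a restricted growth function every letter is preceded by all smaller positive letters, and
this property characterizes restricted growth functions. -/
theorem isRGF_iff {w : List ℕ} :
    IsRGF w ↔ ∀ u x v, w = u ++ x :: v → 1 ≤ x ∧ ∀ y, 1 ≤ y → y < x → y ∈ u := by
  constructor
  · intro h u
    induction hn : u.length using Nat.strong_induction_on generalizing u with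
    | _ n ih =>
    rintro x v rfl
    have hi := h ⟨u.length, by simp⟩
    simp only [List.get_eq_getElem, List.getElem_append_right le_rfl, Nat.sub_self,
      List.getElem_cons_zero, List.take_left] at hi
    refine ⟨hi.1, fun y hy hyx => ?_⟩
    rcases (foldr_max_zero_spec u).2 with h0 | hz
    · omega
    · generalize u.foldr max 0 = z at hi hz
      rcases Nat.lt_or_ge y z with hyz | hyz
      · obtain ⟨u₁, u₂, rfl⟩ := List.append_of_mem hz
        have := (ih u₁.length (by simp at hn; omega) u₁ rfl z (u₂ ++ x :: v) (by simp)).2 y hy hyz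
        simp [this]
      · rwa [show y = z by omega]
  · intro h i
    have hw : w = w.take i ++ w.get i :: w.drop (i + 1) := by simp
    obtain ⟨h1, h2⟩ := h _ _ _ hw
    refine ⟨h1, ?_⟩
    by_contra hlt
    have := (foldr_max_zero_spec (w.take i)).1 (w.get i - 1) (h2 _ (by omega) (by omega))
    omega

theorem isRGF_append_singleton {w : List ℕ} {x : ℕ} :
    IsRGF (w ++ [x]) ↔ IsRGF w ∧ 1 ≤ x ∧ ∀ y, 1 ≤ y → y < x → y ∈ w := by
  simp only [isRGF_iff]
  constructor
  · intro h
    exact ⟨fun u y v hw => h u y (v ++ [x]) (by simp [hw]), h w x [] rfl⟩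
  · rintro ⟨hw, hx⟩ u y v huv
    rcases List.eq_nil_or_concat v with rfl | ⟨v, z, rfl⟩
    · obtain ⟨rfl, h⟩ := List.append_inj' huv rfl
      obtain rfl : x = y := by simpa using h
      exact hx
    · rw [List.concat_eq_append, ← List.cons_append, ← List.append_assoc] at huv
      obtain ⟨h, -⟩ := List.append_inj' huv rfl
      exact hw u y v h

theorem isRGF_nil : IsRGF [] := fun i => i.elim0

theorem IsRGF.pos {w : List ℕ} (h : IsRGF w) {x : ℕ} (hx : x ∈ w) : 1 ≤ x := by
  obtain ⟨u, v, rfl⟩ := List.append_of_mem hx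
  exact (isRGF_iff.1 h _ _ _ rfl).1

theorem IsRGF.mem_of_le {w : List ℕ} (h : IsRGF w) {x y : ℕ} (hx : x ∈ w) (hy : 1 ≤ y)
    (hyx : y ≤ x) : y ∈ w := by
  rcases hyx.eq_or_lt with rfl | hlt
  · exact hx
  · obtain ⟨u, v, rfl⟩ := List.append_of_mem hx
    exact List.mem_append_left _ ((isRGF_iff.1 h _ _ _ rfl).2 y hy hlt)

theorem IsRGF.pair_sublist {w : List ℕ} (h : IsRGF w) {x y : ℕ} (hx : x ∈ w) (hy : 1 ≤ y)
    (hyx : y < x) : [y, x].Sublist w := by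
  obtain ⟨u, v, rfl⟩ := List.append_of_mem hx
  have hyu := (isRGF_iff.1 h _ _ _ rfl).2 y hy hyx
  exact (List.singleton_sublist.2 hyu).append (List.singleton_sublist.2 (List.mem_cons_self ..))

/-- The letters of a restricted growth function are `1, …, m` for some `m`. -/
theorem IsRGF.exists_mem_iff {w : List ℕ} (h : IsRGF w) :
    ∃ m, ∀ x, x ∈ w ↔ 1 ≤ x ∧ x ≤ m := by
  induction w using List.reverseRecOn with
  | nil => exact ⟨0, fun x => by simp; omega⟩
  | append_singleton w x ih =>
    obtain ⟨hw, hx, hxw⟩ := isRGF_append_singleton.1 h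
    obtain ⟨m, hm⟩ := ih hw
    have hxm : x ≤ m + 1 := by
      by_contra hlt
      have := (hm _).1 (hxw (m + 1) (by omega) (by omega))
      omega
    refine ⟨max m x, fun y => ?_⟩
    simp only [List.mem_append, List.mem_singleton, hm]
    omega

theorem IsRGF.eq_one_cons {w : List ℕ} (h : IsRGF w) (hw : w ≠ []) : ∃ v, w = 1 :: v := by
  cases w with
  | nil => exact absurd rfl hw
  | cons x v =>
    obtain ⟨h1, h2⟩ := isRGF_iff.1 h [] x v rfl
    have : ¬ 1 < x := fun hx => by simpa using h2 1 le_rfl hx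
    exact ⟨v, by rw [show x = 1 by omega]⟩

/-- A restricted growth function avoids `121` if and only if it is weakly increasing. -/
theorem IsRGF.avoids_121_iff {w : List ℕ} (h : IsRGF w) :
    ¬ ContainsPattern w [1, 2, 1] ↔ w.Pairwise (· ≤ ·) := by
  rw [containsPattern_121_iff]
  constructor
  · intro hav
    induction w using List.reverseRecOn with
    | nil => simp
    | append_singleton w x ih =>
      obtain ⟨hw, hx, -⟩ := isRGF_append_singleton.1 h
      rw [List.pairwise_append]
      refine ⟨ih hw fun ⟨a, b, hab, hs⟩ => hav ⟨a, b, hab, hs.trans (List.sublist_append_left ..)⟩,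
        by simp, ?_⟩
      intro y hy z hz
      obtain rfl := List.mem_singleton.1 hz
      by_contra hlt
      exact hav ⟨z, y, by omega,
        (hw.pair_sublist hy hx (by omega)).append (List.Sublist.refl [z])⟩
  · rintro hp ⟨x, y, hxy, hs⟩
    have := hp.sublist hs
    simp at this
    omega

/-- A restricted growth function avoids `112` if and only if it is `1 2 ⋯ m` followed by a weakly
decreasing word. -/
theorem IsRGF.eq_range'_append_of_avoids_112 {w : List ℕ} (h : IsRGF w)
    (hav : ¬ ContainsPattern w [1, 1, 2]) :
    ∃ m d, w = List.range' 1 m ++ d ∧ d.Pairwise (· ≥ ·) ∧ ∀ x ∈ d, 1 ≤ x ∧ x ≤ m := by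
  rw [containsPattern_112_iff] at hav
  induction w using List.reverseRecOn with
  | nil => exact ⟨0, [], by simp⟩
  | append_singleton w x ih =>
    obtain ⟨hw, hx, hxw⟩ := isRGF_append_singleton.1 h
    obtain ⟨m, d, rfl, hd, hdm⟩ := ih hw fun ⟨a, b, hab, hs⟩ =>
      hav ⟨a, b, hab, hs.trans (List.sublist_append_left ..)⟩
    have hmem : ∀ y, y ∈ List.range' 1 m ++ d ↔ 1 ≤ y ∧ y ≤ m := by
      intro y
      rw [List.mem_append, List.mem_range'_1]
      constructor
      · rintro (hy | hy)
        · omega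
        · exact hdm y hy
      · omega
    rcases Nat.lt_or_ge m x with hmx | hmx
    · have hxm : x = m + 1 := by
        by_contra hne
        have := (hmem _).1 (hxw (m + 1) (by omega) (by omega))
        omega
      cases d with
      | nil => exact ⟨m + 1, [], by simp [List.range'_1_concat, hxm, Nat.add_comm], by simp, by simp⟩
      | cons y d =>
        have hy := hdm y (by simp)
        refine absurd ⟨y, x, by omega, ?_⟩ hav
        have h1 : [y].Sublist (List.range' 1 m) :=
          List.singleton_sublist.2 (List.mem_range'_1.2 (by omega))
        have h2 : [y].Sublist (y :: d) := List.singleton_sublist.2 (by simp)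
        exact (h1.append h2).append (List.Sublist.refl [x])
    · refine ⟨m, d ++ [x], by simp, ?_, ?_⟩
      · rw [List.pairwise_append]
        refine ⟨hd, by simp, fun y hy z hz => ?_⟩
        obtain rfl := List.mem_singleton.1 hz
        by_contra hlt
        refine hav ⟨y, z, by omega, ?_⟩
        have h1 : [y].Sublist (List.range' 1 m) :=
          List.singleton_sublist.2 (List.mem_range'_1.2 (by have := hdm y hy; omega))
        exact (h1.append (List.singleton_sublist.2 hy)).append (List.Sublist.refl [z])
      · simp only [List.mem_append, List.mem_singleton]
        rintro y (hy | rfl)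
        · exact hdm y hy
        · exact ⟨hx, hmx⟩

theorem avoids_112_of_eq_range'_append {m : ℕ} {d : List ℕ} (hd : d.Pairwise (· ≥ ·)) :
    ¬ ContainsPattern (List.range' 1 m ++ d) [1, 1, 2] := by
  rw [containsPattern_112_iff]
  rintro ⟨x, y, hxy, hs⟩
  obtain ⟨l₁, l₂, hl, h1, h2⟩ := List.sublist_append_iff.1 hs
  have hn : l₁.Nodup := (List.nodup_range' (step := 1)).sublist h1
  have hp := hd.sublist h2
  match l₁, hl with
  | [], hl =>
    obtain rfl : l₂ = [x, x, y] := by simpa using hl.symm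
    simp at hp; omega
  | [a], hl =>
    obtain ⟨-, rfl⟩ : x = a ∧ l₂ = [x, y] := by simpa [eq_comm] using hl
    simp at hp; omega
  | a :: b :: l, hl =>
    simp only [List.cons_append, List.cons.injEq] at hl
    obtain ⟨rfl, rfl, -⟩ := hl
    simp at hn

theorem isRGF_range'_append {m : ℕ} {d : List ℕ} (hd : ∀ x ∈ d, 1 ≤ x ∧ x ≤ m) :
    IsRGF (List.range' 1 m ++ d) := by
  induction d using List.reverseRecOn with
  | nil =>
    rw [List.append_nil]
    clear hd
    induction m with
    | zero => exact isRGF_nil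
    | succ m ih =>
      rw [List.range'_1_concat, isRGF_append_singleton]
      exact ⟨ih, by omega, fun y hy hlt => List.mem_range'_1.2 (by omega)⟩
  | append_singleton d x ih =>
    have hx := hd x (by simp)
    rw [← List.append_assoc, isRGF_append_singleton]
    refine ⟨ih fun y hy => hd y (by simp [hy]), hx.1, fun y hy hlt => ?_⟩
    exact List.mem_append_left _ (List.mem_range'_1.2 (by omega))

theorem isRGF_of_pairwise_le {w : List ℕ} {m : ℕ} (hw : w.Pairwise (· ≤ ·))
    (hm : ∀ x, x ∈ w ↔ 1 ≤ x ∧ x ≤ m) : IsRGF w := by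
  rw [isRGF_iff]
  rintro u x v rfl
  have hx := (hm x).1 (by simp)
  refine ⟨hx.1, fun y hy hyx => ?_⟩
  have hyw := (hm y).2 ⟨hy, by omega⟩
  rcases List.mem_append.1 hyw with h | h
  · exact h
  · have hp := (List.pairwise_append.1 hw).2.1
    rcases List.mem_cons.1 h with h | h
    · omega
    · have := (List.pairwise_cons.1 hp).1 y h
      omega

/-! ### Partitions that avoid `121` or `112` as compositions -/

theorem tau121_append_singleton (b : List ℕ) (y : ℕ) :
    tau121 (b ++ [y]) = tau121 b ++ List.replicate y (b.length + 1) := by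
  simp [tau121, List.mapIdx_append]

/-- The weakly decreasing part `m^{a_m - 1} ⋯ 1^{a₁ - 1}` of `τ₁₁₂(a)`. -/
def tau112Tail (a : List ℕ) : List ℕ :=
  (a.mapIdx fun i x => List.replicate (x - 1) (i + 1)).reverse.flatten

theorem tau112_eq (a : List ℕ) : tau112 a = List.range' 1 a.length ++ tau112Tail a := rfl

theorem tau112Tail_append_singleton (b : List ℕ) (y : ℕ) :
    tau112Tail (b ++ [y]) = List.replicate (y - 1) (b.length + 1) ++ tau112Tail b := by
  simp [tau112Tail, List.mapIdx_append]

theorem tau112_perm_tau121 {b : List ℕ} (hb : ∀ x ∈ b, 0 < x) : (tau112 b).Perm (tau121 b) := by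
  induction b using List.reverseRecOn with
  | nil => simp [tau112, tau121]
  | append_singleton b y ih =>
    have hy := hb y (by simp)
    have ih := ih fun x hx => hb x (by simp [hx])
    rw [tau112_eq] at ih ⊢
    rw [tau121_append_singleton, tau112Tail_append_singleton, List.length_append,
      List.length_singleton, List.range'_1_concat, List.perm_iff_count]
    intro z
    have hz := List.perm_iff_count.1 ih z
    simp only [List.count_append, List.count_replicate, List.count_singleton] at hz ⊢
    rw [Nat.add_comm 1 b.length]
    split_ifs <;> omega

/-- The letter `x` occurs `b_x` times in `τ₁₂₁(b)`; the default value `0` of `List.getD` covers the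
numbers that are not letters. -/
theorem count_tau121 (b : List ℕ) (x : ℕ) : (tau121 b).count x = (0 :: b).getD x 0 := by
  induction b using List.reverseRecOn with
  | nil => cases x <;> simp [tau121]
  | append_singleton b y ih =>
    rw [tau121_append_singleton, List.count_append, ih, List.count_replicate, ← List.cons_append]
    rcases lt_trichotomy x (b.length + 1) with h | h | h
    · rw [List.getD_append _ _ _ _ (by simpa using h)]
      simp; omega
    · subst h
      rw [List.getD_append_right _ _ _ _ (by simp)]
      simp
    · rw [List.getD_append_right _ _ _ _ (by simp; omega), List.getD_eq_default _ _ (by simp; omega),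
        List.getD_eq_default _ _ (by simp; omega)]
      simp; omega

theorem length_tau121 (b : List ℕ) : (tau121 b).length = b.sum := by
  induction b using List.reverseRecOn with
  | nil => simp [tau121]
  | append_singleton b y ih => simp [tau121_append_singleton, ih]

theorem mem_tau121 {b : List ℕ} (hb : ∀ x ∈ b, 0 < x) (x : ℕ) :
    x ∈ tau121 b ↔ 1 ≤ x ∧ x ≤ b.length := by
  rw [← List.count_pos_iff, count_tau121]
  cases x with
  | zero => simp
  | succ x =>
    rw [List.getD_cons_succ]
    rcases Nat.lt_or_ge x b.length with h | h
    · rw [List.getD_eq_getElem _ _ h]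
      have := hb _ (List.getElem_mem h)
      omega
    · rw [List.getD_eq_default _ _ h]
      omega

theorem tau121_injOn : Set.InjOn tau121 {b | ∀ x ∈ b, 0 < x} := by
  intro a ha b hb h
  have hlen : a.length = b.length := by
    have h1 := mem_tau121 ha
    have h2 := mem_tau121 hb
    rw [h] at h1
    have h3 := (h1 a.length).symm.trans (h2 a.length)
    have h4 := (h1 b.length).symm.trans (h2 b.length)
    omega
  refine List.ext_getElem hlen fun i h1 h2 => ?_
  have hc := congrArg (List.count (i + 1)) h
  rwa [count_tau121, count_tau121, List.getD_cons_succ, List.getD_cons_succ,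
    List.getD_eq_getElem _ _ h1, List.getD_eq_getElem _ _ h2] at hc

theorem pairwise_tau121 (b : List ℕ) : (tau121 b).Pairwise (· ≤ ·) := by
  induction b using List.reverseRecOn with
  | nil => simp [tau121]
  | append_singleton b y ih =>
    rw [tau121_append_singleton, List.pairwise_append]
    refine ⟨ih, List.pairwise_replicate.2 (Or.inr le_rfl), fun x hx z hz => ?_⟩
    rw [List.eq_of_mem_replicate hz]
    by_contra hlt
    rw [← List.count_pos_iff, count_tau121, List.getD_eq_default _ _ (by simp; omega)] at hx
    exact hx.false

theorem tau112_injOn : Set.InjOn tau112 {b | ∀ x ∈ b, 0 < x} := by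
  intro a ha b hb h
  refine tau121_injOn ha hb ?_
  have hp : (tau121 a).Perm (tau121 b) :=
    ((tau112_perm_tau121 ha).symm.trans (h ▸ .refl _)).trans (tau112_perm_tau121 hb)
  exact hp.eq_of_pairwise (fun _ _ _ _ => le_antisymm) (pairwise_tau121 a) (pairwise_tau121 b)

theorem pairwise_tau112Tail {b : List ℕ} (hb : ∀ x ∈ b, 0 < x) :
    (tau112Tail b).Pairwise (· ≥ ·) ∧ ∀ x ∈ tau112Tail b, 1 ≤ x ∧ x ≤ b.length := by
  have hmem : ∀ b : List ℕ, (∀ x ∈ b, 0 < x) → ∀ x ∈ tau112Tail b, 1 ≤ x ∧ x ≤ b.length := by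
    intro b hb x hx
    exact (mem_tau121 hb x).1 ((tau112_perm_tau121 hb).subset (by simp [tau112_eq, hx]))
  refine ⟨?_, hmem b hb⟩
  induction b using List.reverseRecOn with
  | nil => simp [tau112Tail]
  | append_singleton b y ih =>
    have hb' : ∀ x ∈ b, 0 < x := fun x hx => hb x (by simp [hx])
    rw [tau112Tail_append_singleton, List.pairwise_append]
    refine ⟨List.pairwise_replicate.2 (Or.inr le_rfl), ih hb', fun x hx z hz => ?_⟩
    rw [List.eq_of_mem_replicate hx]
    have := hmem b hb' z hz
    omega

theorem count_tau112Tail {b : List ℕ} (hb : ∀ x ∈ b, 0 < x) (x : ℕ) :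
    (tau112Tail b).count x = (0 :: b).getD x 0 - 1 := by
  have h := (tau112_perm_tau121 hb).count_eq x
  rw [tau112_eq, List.count_append, count_tau121] at h
  by_cases hx : x ∈ List.range' 1 b.length
  · rw [List.count_eq_one_of_mem List.nodup_range' hx] at h
    omega
  · have h0 : (tau112Tail b).count x = 0 := by
      refine List.count_eq_zero.2 fun hmem => hx ?_
      have := (pairwise_tau112Tail hb).2 x hmem
      exact List.mem_range'_1.2 (by omega)
    rw [List.count_eq_zero.2 hx, h0] at h
    omega

/-- The composition that records the multiplicities of the letters `1, …, m` of `w`. -/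
def letterCounts (w : List ℕ) (m : ℕ) : List ℕ := (List.range m).map fun j => w.count (j + 1)

theorem letterCounts_pos {w : List ℕ} {m : ℕ} (hm : ∀ x, x ∈ w ↔ 1 ≤ x ∧ x ≤ m) :
    ∀ x ∈ letterCounts w m, 0 < x := by
  simp only [letterCounts, List.mem_map, List.mem_range]
  rintro _ ⟨j, hj, rfl⟩
  exact List.count_pos_iff.2 ((hm _).2 (by omega))

theorem tau121_letterCounts_perm {w : List ℕ} {m : ℕ} (hm : ∀ x, x ∈ w ↔ 1 ≤ x ∧ x ≤ m) :
    (tau121 (letterCounts w m)).Perm w := by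
  rw [List.perm_iff_count]
  intro x
  rw [count_tau121]
  cases x with
  | zero =>
    rw [List.count_eq_zero.2 fun h => absurd ((hm 0).1 h).1 (by norm_num)]
    rfl
  | succ x =>
    rw [List.getD_cons_succ]
    rcases Nat.lt_or_ge x m with h | h
    · rw [List.getD_eq_getElem _ _ (by simpa [letterCounts] using h)]
      simp [letterCounts]
    · rw [List.getD_eq_default _ _ (by simpa [letterCounts] using h),
        List.count_eq_zero.2 fun h' => absurd ((hm _).1 h').2 (by omega)]

/-- Containment forces domination: the letter `j` of the pattern and the letter `f j` of the word
satisfy `a_j ≤ b_{f j}`. Only the multiplicities of the letters matter here. -/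
theorem dominates_of_containsPattern {a b u v : List ℕ} (ha : ∀ x ∈ a, 0 < x)
    (hb : ∀ x ∈ b, 0 < x) (hu : u.Perm (tau121 a)) (hv : v.Perm (tau121 b))
    (h : ContainsPattern v u) : Dominates b a := by
  obtain ⟨f, hf, hs⟩ := containsPattern_iff.1 h
  have hmem : ∀ j : Fin a.length, (j : ℕ) + 1 ∈ u := fun j =>
    hu.mem_iff.2 ((mem_tau121 ha _).2 (by omega))
  have hfm : ∀ j : Fin a.length, 1 ≤ f (j + 1) ∧ f (j + 1) ≤ b.length := fun j =>
    (mem_tau121 hb _).1 (hv.mem_iff.1 (hs.subset (List.mem_map_of_mem (hmem j))))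
  refine ⟨fun j => ⟨f (j + 1) - 1, by have := hfm j; omega⟩, fun i j hij => ?_, fun j => ?_⟩
  · have := hf (hmem i) (hmem j) (by simpa using hij)
    have := hfm i
    simp only [Fin.mk_lt_mk]
    omega
  · have h1 : u.count ((j : ℕ) + 1) ≤ v.count (f ((j : ℕ) + 1)) :=
      (List.count_le_count_map (f := f)).trans (hs.count_le _)
    obtain ⟨c, hc⟩ : ∃ c, f (j + 1) = c + 1 := ⟨f (j + 1) - 1, by have := hfm j; omega⟩
    have hcb : c < b.length := by have := hfm j; omega
    rw [hu.count_eq, hv.count_eq, count_tau121, count_tau121, hc, List.getD_cons_succ,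
      List.getD_cons_succ, List.getD_eq_getElem _ _ j.2, List.getD_eq_getElem _ _ hcb] at h1
    simpa [hc] using h1

/-- An embedding that witnesses domination, extended to a strictly increasing map on all of `ℕ` and
shifted so as to act on letters. -/
theorem Dominates.exists_strictMono {a b : List ℕ} (h : Dominates b a) :
    ∃ f : ℕ → ℕ, StrictMono f ∧ (∀ x, 1 ≤ x → x ≤ a.length → 1 ≤ f x ∧ f x ≤ b.length) ∧
      ∀ x, (0 :: a).getD x 0 ≤ (0 :: b).getD (f x) 0 := by
  obtain ⟨i, hi, hle⟩ := h
  refine ⟨fun x => if hx : 1 ≤ x ∧ x ≤ a.length then (i ⟨x - 1, by omega⟩ : ℕ) + 1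
    else if x = 0 then 0 else b.length + x, ?_, ?_, ?_⟩
  · intro x y hxy
    by_cases hx : 1 ≤ x ∧ x ≤ a.length <;> by_cases hy : 1 ≤ y ∧ y ≤ a.length
    · simp only [dif_pos hx, dif_pos hy]
      have := hi (show (⟨x - 1, by omega⟩ : Fin a.length) < ⟨y - 1, by omega⟩ by
        simp only [Fin.mk_lt_mk]; omega)
      rw [Fin.lt_def] at this
      omega
    · simp only [dif_pos hx, dif_neg hy]
      rw [if_neg (by omega)]
      have := (i ⟨x - 1, by omega⟩).2
      omega
    · simp only [dif_neg hx, dif_pos hy]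
      rw [if_pos (by omega)]
      omega
    · simp only [dif_neg hx, dif_neg hy]
      split_ifs <;> omega
  · intro x h1 h2
    simp only [dif_pos (show 1 ≤ x ∧ x ≤ a.length from ⟨h1, h2⟩)]
    have := (i ⟨x - 1, by omega⟩).2
    omega
  · intro x
    cases x with
    | zero => simp
    | succ x =>
      rw [List.getD_cons_succ]
      rcases Nat.lt_or_ge x a.length with h | h
      · simp only [dif_pos (show 1 ≤ x + 1 ∧ x + 1 ≤ a.length by omega)]
        rw [List.getD_cons_succ, List.getD_eq_getElem _ _ h, List.getD_eq_getElem _ _ (Fin.is_lt _)]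
        exact hle ⟨x, h⟩
      · rw [List.getD_eq_default _ _ h]
        exact Nat.zero_le _

theorem containsPattern_tau121_iff {a b : List ℕ} (ha : ∀ x ∈ a, 0 < x) (hb : ∀ x ∈ b, 0 < x) :
    ContainsPattern (tau121 b) (tau121 a) ↔ Dominates b a := by
  refine ⟨dominates_of_containsPattern ha hb (.refl _) (.refl _), fun h => ?_⟩
  obtain ⟨f, hf, -, hle⟩ := h.exists_strictMono
  refine containsPattern_iff.2 ⟨f, hf.strictMonoOn _, ?_⟩
  refine List.sublist_of_subperm_of_pairwise ?_
    ((pairwise_tau121 a).map f fun x y hxy => hf.monotone hxy) (pairwise_tau121 b)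
  rw [List.subperm_ext_iff]
  intro z hz
  obtain ⟨x, -, rfl⟩ := List.mem_map.1 hz
  rw [List.count_map_of_injective _ _ hf.injective, count_tau121, count_tau121]
  exact hle x

theorem containsPattern_tau112_iff {a b : List ℕ} (ha : ∀ x ∈ a, 0 < x) (hb : ∀ x ∈ b, 0 < x) :
    ContainsPattern (tau112 b) (tau112 a) ↔ Dominates b a := by
  refine ⟨dominates_of_containsPattern ha hb (tau112_perm_tau121 ha) (tau112_perm_tau121 hb),
    fun h => ?_⟩
  obtain ⟨f, hf, hfm, hle⟩ := h.exists_strictMono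
  refine containsPattern_iff.2 ⟨f, hf.strictMonoOn _, ?_⟩
  rw [tau112_eq, tau112_eq, List.map_append]
  refine List.Sublist.append ?_ ?_
  · refine List.sublist_of_subperm_of_pairwise (r := (· ≤ ·)) ?_
      ((List.pairwise_le_range').map f fun x y hxy => hf.monotone hxy) List.pairwise_le_range'
    refine (List.Nodup.map hf.injective List.nodup_range').subperm fun z hz => ?_
    obtain ⟨x, hx, rfl⟩ := List.mem_map.1 hz
    rw [List.mem_range'_1] at hx ⊢
    have := hfm x (by omega) (by omega)
    omega
  · refine List.sublist_of_subperm_of_pairwise (r := (· ≥ ·)) ?_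
      ((pairwise_tau112Tail ha).1.map f fun x y hxy => hf.monotone hxy) (pairwise_tau112Tail hb).1
    rw [List.subperm_ext_iff]
    intro z hz
    obtain ⟨x, -, rfl⟩ := List.mem_map.1 hz
    rw [List.count_map_of_injective _ _ hf.injective, count_tau112Tail ha, count_tau112Tail hb]
    exact Nat.sub_le_sub_right (hle x) 1

theorem image_tau121 (n : ℕ) :
    tau121 '' (compositionLists n : Set (List ℕ)) = avoiders n {[1, 2, 1]} := by
  ext w
  simp only [Set.mem_image, Finset.mem_coe, mem_compositionLists, avoiders, Set.mem_ofPred_eq,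
    Set.mem_singleton_iff, forall_eq]
  constructor
  · rintro ⟨b, ⟨hb, rfl⟩, rfl⟩
    have hr := isRGF_of_pairwise_le (pairwise_tau121 b) (mem_tau121 hb)
    exact ⟨hr, length_tau121 b, hr.avoids_121_iff.2 (pairwise_tau121 b)⟩
  · rintro ⟨hw, rfl, hav⟩
    obtain ⟨m, hm⟩ := hw.exists_mem_iff
    have hp := tau121_letterCounts_perm hm
    refine ⟨letterCounts w m, ⟨letterCounts_pos hm, ?_⟩, ?_⟩
    · rw [← length_tau121, hp.length_eq]
    · exact hp.eq_of_pairwise (fun _ _ _ _ => le_antisymm) (pairwise_tau121 _)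
        (hw.avoids_121_iff.1 hav)

theorem image_tau112 (n : ℕ) :
    tau112 '' (compositionLists n : Set (List ℕ)) = avoiders n {[1, 1, 2]} := by
  ext w
  simp only [Set.mem_image, Finset.mem_coe, mem_compositionLists, avoiders, Set.mem_ofPred_eq,
    Set.mem_singleton_iff, forall_eq]
  constructor
  · rintro ⟨b, ⟨hb, rfl⟩, rfl⟩
    obtain ⟨h1, h2⟩ := pairwise_tau112Tail hb
    exact ⟨isRGF_range'_append h2, by rw [(tau112_perm_tau121 hb).length_eq, length_tau121],
      avoids_112_of_eq_range'_append h1⟩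
  · rintro ⟨hw, rfl, hav⟩
    obtain ⟨m, d, rfl, hd, hdm⟩ := hw.eq_range'_append_of_avoids_112 hav
    have hm : ∀ x, x ∈ List.range' 1 m ++ d ↔ 1 ≤ x ∧ x ≤ m := by
      intro y
      rw [List.mem_append, List.mem_range'_1]
      constructor
      · rintro (hy | hy)
        · omega
        · exact hdm y hy
      · omega
    have hpos := letterCounts_pos hm
    have hp := (tau112_perm_tau121 hpos).trans (tau121_letterCounts_perm hm)
    refine ⟨letterCounts _ m, ⟨hpos, ?_⟩, ?_⟩
    · rw [← length_tau121, (tau121_letterCounts_perm hm).length_eq]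
    · have hlen : (letterCounts (List.range' 1 m ++ d) m).length = m := by simp [letterCounts]
      rw [tau112_eq, hlen] at hp ⊢
      rw [((List.perm_append_left_iff _).1 hp).eq_of_pairwise (fun _ _ _ _ h h' => le_antisymm h' h)
        (pairwise_tau112Tail hpos).1 hd]

/-- If `code` identifies the compositions of `n` with the avoiders of `σ`, and containment of `π`
with domination of `a`, then the avoiders of `{σ, π}` are the compositions that do not dominate
`a`. -/
theorem ncard_avoiders_add_dominatingCount {n : ℕ} {σ π a : List ℕ} {code : List ℕ → List ℕ}
    (hinj : Set.InjOn code {b | ∀ x ∈ b, 0 < x})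
    (himage : code '' (compositionLists n : Set (List ℕ)) = avoiders n {σ})
    (hcont : ∀ b, (∀ x ∈ b, 0 < x) → (ContainsPattern (code b) π ↔ Dominates b a)) :
    (avoiders n {σ, π}).ncard + dominatingCount a n = 2 ^ (n - 1) := by
  classical
  have h : avoiders n {σ, π} =
      code '' ((compositionLists n \ dominatingLists a n : Finset (List ℕ)) : Set (List ℕ)) := by
    have h1 : avoiders n {σ, π} = {w ∈ avoiders n {σ} | ¬ ContainsPattern w π} := by
      ext w
      simp [avoiders, and_assoc]
    rw [h1, ← himage]
    ext w
    simp only [Set.mem_ofPred_eq, Set.mem_image, Finset.mem_coe, Finset.mem_sdiff,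
      mem_dominatingLists, mem_compositionLists]
    constructor
    · rintro ⟨⟨b, hb, rfl⟩, hav⟩
      rw [hcont b hb.1, dominates_iff_sublistForall₂] at hav
      exact ⟨b, ⟨hb, fun h => hav h.2⟩, rfl⟩
    · rintro ⟨b, ⟨hb, hd⟩, rfl⟩
      refine ⟨⟨b, hb, rfl⟩, ?_⟩
      rw [hcont b hb.1, dominates_iff_sublistForall₂]
      exact fun h => hd ⟨hb, h⟩
  have hsub : dominatingLists a n ⊆ compositionLists n := fun b hb =>
    mem_compositionLists.2 (mem_dominatingLists.1 hb).1
  rw [h, Set.InjOn.ncard_image, Set.ncard_coe_finset, Finset.card_sdiff_of_subset hsub,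
    dominatingCount, Nat.sub_add_cancel (Finset.card_le_card hsub), card_compositionLists]
  exact hinj.mono fun b hb =>
    (mem_compositionLists.1 (Finset.mem_sdiff.1 (Finset.mem_coe.1 hb)).1).1

theorem ncard_avoiders_121 (n : ℕ) {k : ℕ} (a : Composition k) :
    (avoiders n {[1, 2, 1], tau121 a.blocks}).ncard + dominatingCount a.blocks n = 2 ^ (n - 1) :=
  ncard_avoiders_add_dominatingCount tau121_injOn (image_tau121 n) fun _ hb =>
    containsPattern_tau121_iff (fun _ hx => a.blocks_pos hx) hb

theorem ncard_avoiders_112 (n : ℕ) {k : ℕ} (a : Composition k) :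
    (avoiders n {[1, 1, 2], tau112 a.blocks}).ncard + dominatingCount a.blocks n = 2 ^ (n - 1) :=
  ncard_avoiders_add_dominatingCount tau112_injOn (image_tau112 n) fun _ hb =>
    containsPattern_tau112_iff (fun _ hx => a.blocks_pos hx) hb

/-! ### Binary words that contain a given subword -/

/-- The binary words of length `n`. -/
def binaryWords : ℕ → Finset (List Bool)
  | 0 => {[]}
  | n + 1 => (binaryWords n).image (List.cons true) ∪ (binaryWords n).image (List.cons false)

theorem mem_binaryWords {n : ℕ} {δ : List Bool} : δ ∈ binaryWords n ↔ δ.length = n := by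
  induction n generalizing δ with
  | zero => simp [binaryWords]
  | succ n ih =>
    rcases δ with _ | ⟨_ | _, δ⟩ <;> simp [binaryWords, ih]

theorem card_binaryWords (n : ℕ) : (binaryWords n).card = 2 ^ n := by
  induction n with
  | zero => simp [binaryWords]
  | succ n ih =>
    rw [binaryWords, Finset.card_union_of_disjoint,
      Finset.card_image_of_injective _ List.cons_injective,
      Finset.card_image_of_injective _ List.cons_injective, ih, pow_succ]
    · ring
    · rw [Finset.disjoint_left]
      simp

/-- The number of binary words of length `n` that contain `ε` as a subword. -/
def superwordCount (ε : List Bool) (n : ℕ) : ℕ :=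
  ((binaryWords n).filter fun δ => ε.Sublist δ).card

theorem superwordCount_cons_succ (e : Bool) (ε : List Bool) (n : ℕ) :
    superwordCount (e :: ε) (n + 1) = superwordCount (e :: ε) n + superwordCount ε n := by
  have hB : binaryWords (n + 1) =
      (binaryWords n).image (List.cons e) ∪ (binaryWords n).image (List.cons !e) := by
    cases e
    · exact Finset.union_comm _ _
    · rfl
  have hne : ∀ δ : List Bool, (e :: ε).Sublist ((!e) :: δ) ↔ (e :: ε).Sublist δ := by
    intro δ
    rw [List.sublist_cons_iff]
    simp
  rw [superwordCount, hB, Finset.filter_union, Finset.card_union_of_disjoint, Finset.filter_image,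
    Finset.filter_image, Finset.card_image_of_injective _ List.cons_injective,
    Finset.card_image_of_injective _ List.cons_injective, add_comm]
  · simp only [hne, List.cons_sublist_cons, superwordCount]
  · rw [Finset.disjoint_left]
    intro δ h1 h2
    simp only [Finset.mem_filter, Finset.mem_image] at h1 h2
    obtain ⟨⟨x, -, rfl⟩, -⟩ := h1
    obtain ⟨⟨y, -, h⟩, -⟩ := h2
    simp at h

/-- A composition of `n + 1` that dominates `(1, a)` either consists of a term `1` and a composition
of `n` that dominates `a`, or its first term can be decreased by one, which gives a composition of
`n` that dominates `(1, a)`. -/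
theorem dominatingCount_one_cons_succ (a : List ℕ) (n : ℕ) :
    dominatingCount (1 :: a) (n + 1) = dominatingCount (1 :: a) n + dominatingCount a n := by
  have h : ∀ n, dominatingCount (1 :: a) n = ∑ p ∈ Finset.HasAntidiagonal.antidiagonal n,
      if 1 ≤ p.1 then dominatingCount a p.2 else 0 := by
    intro n
    rw [dominatingCount_cons]
    exact Finset.sum_congr rfl fun p _ => by split_ifs <;> rfl
  have hs : ∀ n, ∑ p ∈ Finset.HasAntidiagonal.antidiagonal n, dominatingCount a p.2 =
      dominatingCount (1 :: a) n + dominatingCount a n := by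
    intro n
    rw [h]
    cases n with
    | zero => simp
    | succ n => simp [Finset.Nat.antidiagonal_succ]; ring
  rw [← hs, h, Finset.Nat.antidiagonal_succ]
  simp

/-- The number of superwords depends on the length of the subword only. -/
theorem superwordCount_eq_dominatingCount (ε : List Bool) (n : ℕ) :
    superwordCount ε n = dominatingCount (List.replicate (ε.length + 1) 1) (n + 1) := by
  induction n generalizing ε with
  | zero =>
    cases ε with
    | nil =>
      simp [superwordCount, binaryWords, dominatingCount_one_cons_succ, dominatingCount_eq_zero]
      simp [dominatingCount, dominatingLists_nil, card_compositionLists]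
    | cons e ε =>
      rw [dominatingCount_eq_zero (by simp)]
      simp [superwordCount, binaryWords]
  | succ n ih =>
    cases ε with
    | nil =>
      have h1 := ih []
      simp only [List.length_nil, zero_add, List.replicate_one, superwordCount, List.nil_sublist,
        Finset.filter_true, card_binaryWords] at h1 ⊢
      rw [dominatingCount_one_cons_succ, ← h1, dominatingCount, dominatingLists_nil,
        card_compositionLists, pow_succ]
      simp
      ring
    | cons e ε =>
      rw [superwordCount_cons_succ, List.length_cons, List.replicate_succ,
        dominatingCount_one_cons_succ, ih, ih]
      rfl

/-! ### Partitions that avoid `122` or `123` as binary words -/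

/-- The binary word that records, after the initial letter, which letters of `w` are equal
to `1`. -/
def onesCode (w : List ℕ) : List Bool := w.tail.map (· == 1)

theorem onesCode_append_singleton {w : List ℕ} (hw : w ≠ []) (x : ℕ) :
    onesCode (w ++ [x]) = onesCode w ++ [x == 1] := by
  rw [onesCode, List.tail_append_of_ne_nil hw, List.map_append]
  rfl

/-- A restricted growth function avoids `122` if and only if every letter other than `1` exceeds
all its predecessors. -/
theorem IsRGF.avoids_122_iff {w : List ℕ} (h : IsRGF w) :
    ¬ ContainsPattern w [1, 2, 2] ↔ w.Pairwise fun x y => y ≠ 1 → x < y := by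
  rw [containsPattern_122_iff]
  constructor
  · intro hav
    induction w using List.reverseRecOn with
    | nil => simp
    | append_singleton w x ih =>
      obtain ⟨hw, hx, -⟩ := isRGF_append_singleton.1 h
      rw [List.pairwise_append]
      refine ⟨ih hw fun ⟨a, b, hab, hs⟩ => hav ⟨a, b, hab, hs.trans (List.sublist_append_left ..)⟩,
        by simp, ?_⟩
      intro y hy z hz hz1
      obtain rfl := List.mem_singleton.1 hz
      by_contra hlt
      exact hav ⟨1, z, by omega,
        (hw.pair_sublist (hw.mem_of_le hy hx (by omega)) le_rfl (by omega)).append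
          (List.Sublist.refl [z])⟩
  · rintro hp ⟨x, y, hxy, hs⟩
    have hx := h.pos (hs.subset (show x ∈ [x, y, y] by simp))
    have := hp.sublist hs
    simp only [List.pairwise_cons, List.mem_cons, List.not_mem_nil, or_false] at this
    have := this.2.1 y rfl (by omega)
    omega

/-- A restricted growth function avoids `123` if and only if all its letters are `1` or `2`. -/
theorem IsRGF.avoids_123_iff {w : List ℕ} (h : IsRGF w) :
    ¬ ContainsPattern w [1, 2, 3] ↔ ∀ x ∈ w, x ≤ 2 := by
  rw [containsPattern_123_iff]
  constructor
  · intro hav x hx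
    by_contra hlt
    obtain ⟨u, v, rfl⟩ := List.append_of_mem hx
    have hu : IsRGF u := isRGF_iff.2 fun a y b hab => isRGF_iff.1 h a y (b ++ x :: v) (by simp [hab])
    have h2 := (isRGF_iff.1 h _ _ _ rfl).2 2 (by norm_num) (by omega)
    exact hav ⟨1, 2, x, by norm_num, by omega,
      (hu.pair_sublist h2 le_rfl (by norm_num)).append (List.singleton_sublist.2 (by simp))⟩
  · rintro h2 ⟨x, y, z, hxy, hyz, hs⟩
    have hx := h.pos (hs.subset (show x ∈ [x, y, z] by simp))
    have hz := h2 z (hs.subset (by simp))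
    omega

theorem existsUnique_onesCode_122 (δ : List Bool) :
    ∃! w, (IsRGF w ∧ w ≠ [] ∧ ¬ ContainsPattern w [1, 2, 2]) ∧ onesCode w = δ := by
  have step : ∀ {w : List ℕ} {x : ℕ}, w ≠ [] →
      (IsRGF (w ++ [x]) ∧ w ++ [x] ≠ [] ∧ ¬ ContainsPattern (w ++ [x]) [1, 2, 2] ↔
        (IsRGF w ∧ w ≠ [] ∧ ¬ ContainsPattern w [1, 2, 2]) ∧
          (x = 1 ∨ 1 < x ∧ ∀ y, y ∈ w ↔ 1 ≤ y ∧ y < x)) := by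
    intro w x hw0
    constructor
    · rintro ⟨hr, -, hav⟩
      have hp := hr.avoids_122_iff.1 hav
      obtain ⟨hw, hx, hxw⟩ := isRGF_append_singleton.1 hr
      rw [List.pairwise_append] at hp
      refine ⟨⟨hw, hw0, hw.avoids_122_iff.2 hp.1⟩, ?_⟩
      by_cases hx1 : x = 1
      · exact Or.inl hx1
      · refine Or.inr ⟨by omega, fun y => ⟨fun hy => ?_, fun hy => hxw y hy.1 hy.2⟩⟩
        exact ⟨hw.pos hy, hp.2.2 y hy x (by simp) hx1⟩
    · rintro ⟨⟨hw, -, hav⟩, hx⟩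
      have hr : IsRGF (w ++ [x]) := by
        refine isRGF_append_singleton.2 ⟨hw, by omega, fun y hy hyx => ?_⟩
        rcases hx with rfl | ⟨-, hx⟩
        · omega
        · exact (hx y).2 ⟨hy, hyx⟩
      refine ⟨hr, by simp, hr.avoids_122_iff.2 ?_⟩
      rw [List.pairwise_append]
      refine ⟨hw.avoids_122_iff.1 hav, by simp, fun y hy z hz hz1 => ?_⟩
      obtain rfl := List.mem_singleton.1 hz
      rcases hx with rfl | ⟨-, hx⟩
      · exact absurd rfl hz1
      · exact ((hx y).1 hy).2
  induction δ using List.reverseRecOn with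
  | nil =>
    refine ⟨[1], ⟨⟨?_, by simp, ?_⟩, rfl⟩, ?_⟩
    · exact isRGF_append_singleton.2 ⟨isRGF_nil, le_rfl, fun y hy hy1 => by omega⟩
    · rw [containsPattern_122_iff]
      rintro ⟨x, y, -, hs⟩
      simpa using hs.length_le
    · rintro w ⟨⟨hw, hw0, -⟩, hc⟩
      obtain ⟨v, rfl⟩ := hw.eq_one_cons hw0
      simpa [onesCode] using hc
  | append_singleton δ d ih =>
    obtain ⟨w, ⟨hw, hc⟩, huniq⟩ := ih
    obtain ⟨m, hm⟩ := hw.1.exists_mem_iff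
    have hm1 : 1 ≤ m := by
      obtain ⟨v, rfl⟩ := hw.1.eq_one_cons hw.2.1
      exact ((hm 1).1 (by simp)).2
    refine ⟨w ++ [if d then 1 else m + 1], ⟨(step hw.2.1).2 ⟨hw, ?_⟩, ?_⟩, ?_⟩
    · cases d
      · refine Or.inr ⟨by simp; omega, fun y => ?_⟩
        rw [hm]
        simp
      · exact Or.inl rfl
    · rw [onesCode_append_singleton hw.2.1, hc]
      cases d
      · simp; omega
      · simp
    · rintro w' ⟨hw', hc'⟩
      rcases List.eq_nil_or_concat w' with rfl | ⟨v, x, rfl⟩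
      · exact absurd rfl hw'.2.1
      rw [List.concat_eq_append] at hw' hc' ⊢
      have hv0 : v ≠ [] := by
        rintro rfl
        simp [onesCode] at hc'
      obtain ⟨hv, hx⟩ := (step hv0).1 hw'
      rw [onesCode_append_singleton hv0] at hc'
      obtain ⟨h1, h2⟩ := List.append_inj' hc' rfl
      obtain rfl := huniq v ⟨hv, h1⟩
      obtain rfl : (x == 1) = d := by simpa using h2
      rcases hx with rfl | ⟨hx1, hx⟩
      · rfl
      · have h3 := (hx m).1 ((hm m).2 ⟨hm1, le_rfl⟩)
        have h4 := mt (hx (m + 1)).2 (fun h => by have := (hm _).1 h; omega)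
        rw [if_neg (by simp; omega), show x = m + 1 by omega]

theorem existsUnique_onesCode_123 (δ : List Bool) :
    ∃! w, (IsRGF w ∧ w ≠ [] ∧ ¬ ContainsPattern w [1, 2, 3]) ∧ onesCode w = δ := by
  have hr : IsRGF (1 :: δ.map fun d => if d then 1 else 2) := by
    rw [isRGF_iff]
    rintro (_ | ⟨z, u⟩) x v h
    · obtain ⟨rfl, -⟩ := List.cons.inj h
      exact ⟨le_rfl, fun y hy hy1 => by omega⟩
    · rw [List.cons_append] at h
      obtain ⟨rfl, htail⟩ := List.cons.inj h
      have hx : x ∈ δ.map fun d => if d then 1 else 2 := by rw [htail]; simp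
      obtain ⟨d, -, rfl⟩ := List.mem_map.1 hx
      refine ⟨by split_ifs <;> norm_num, fun y hy hyx => ?_⟩
      obtain rfl : y = 1 := by split_ifs at hyx <;> omega
      simp
  refine ⟨1 :: δ.map fun d => if d then 1 else 2, ⟨⟨hr, by simp, ?_⟩, ?_⟩, ?_⟩
  · rw [hr.avoids_123_iff]
    intro x hx
    rcases List.mem_cons.1 hx with rfl | hx
    · norm_num
    · obtain ⟨d, -, rfl⟩ := List.mem_map.1 hx
      split_ifs <;> norm_num
  · rw [onesCode, List.tail_cons, List.map_map]
    conv_rhs => rw [← List.map_id δ]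
    exact List.map_congr_left fun d _ => by cases d <;> rfl
  · rintro w ⟨⟨hw, hw0, hav⟩, rfl⟩
    rw [hw.avoids_123_iff] at hav
    obtain ⟨v, rfl⟩ := hw.eq_one_cons hw0
    rw [onesCode, List.tail_cons, List.map_map]
    congr 1
    conv_lhs => rw [← List.map_id v]
    refine List.map_congr_left fun x hx => ?_
    have h1 := hw.pos (List.mem_cons_of_mem _ hx)
    have h2 := hav x (List.mem_cons_of_mem _ hx)
    obtain rfl | rfl : x = 1 ∨ x = 2 := by omega
    · rfl
    · rfl

theorem containsPattern_122_avoiders_iff {w t : List ℕ}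
    (hw : IsRGF w ∧ w ≠ [] ∧ ¬ ContainsPattern w [1, 2, 2])
    (ht : IsRGF t ∧ t ≠ [] ∧ ¬ ContainsPattern t [1, 2, 2]) :
    ContainsPattern w t ↔ (onesCode t).Sublist (onesCode w) := by
  have hpw := hw.1.avoids_122_iff.1 hw.2.2
  have hpt := ht.1.avoids_122_iff.1 ht.2.2
  have hpos := fun x => hw.1.pos (x := x)
  obtain ⟨v, rfl⟩ := hw.1.eq_one_cons hw.2.1
  obtain ⟨s, rfl⟩ := ht.1.eq_one_cons ht.2.1
  have hst : ∀ x ∈ s, 1 ≤ x := fun x hx => ht.1.pos (List.mem_cons_of_mem _ hx)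
  simp only [onesCode, List.tail_cons]
  constructor
  · intro h
    obtain ⟨f, hf, hs⟩ := containsPattern_iff.1 h
    have h1 : (1 : ℕ) ∈ {x | x ∈ 1 :: s} := by simp
    have hmap : (s.map f).Sublist v ∧ ∀ x ∈ s, (f x == 1) = (x == 1) := by
      by_cases hf1 : f 1 = 1
      · rw [List.map_cons, hf1, List.cons_sublist_cons] at hs
        refine ⟨hs, fun x hx => ?_⟩
        have hx1 := hst x hx
        rcases hx1.eq_or_lt with rfl | hlt
        · simp [hf1]
        · have := hf h1 (List.mem_cons_of_mem _ hx) hlt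
          rw [beq_false_of_ne (by omega), beq_false_of_ne (by omega)]
      · -- the letter `1` of the pattern is matched with a letter of multiplicity one
        have hf1' := hpos _ (hs.subset (List.mem_map_of_mem h1))
        have hne : ∀ x ∈ s, x ≠ 1 := by
          rintro x hx rfl
          have hss : [f 1, f 1].Sublist (1 :: v) :=
            (((List.singleton_sublist.2 hx).cons_cons 1).map f).trans hs
          have := hpw.sublist hss
          simp at this
          omega
        have hfx : ∀ x ∈ s, f x ≠ 1 := by
          intro x hx
          have := hf h1 (List.mem_cons_of_mem _ hx) (by
            have := hst x hx
            have := hne x hx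
            omega)
          omega
        constructor
        · rw [List.map_cons] at hs
          rcases List.sublist_cons_iff.1 hs with h | ⟨r, hr, -⟩
          · exact (List.sublist_cons_self _ _).trans h
          · exact absurd (List.cons.inj hr).1 hf1
        · intro x hx
          rw [beq_false_of_ne (hfx x hx), beq_false_of_ne (hne x hx)]
    have := hmap.1.map (· == 1)
    have hcongr : s.map ((· == 1) ∘ f) = s.map (· == 1) := List.map_congr_left hmap.2
    rwa [List.map_map, hcongr] at this
  · intro h
    obtain ⟨r, hrv, hr⟩ := List.sublist_map_iff.1 h
    have hlen : s.length = r.length := by simpa using congrArg List.length hr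
    have hsub : (1 :: r).Sublist (1 :: v) := hrv.cons_cons 1
    have hpr := hpw.sublist hsub
    have hlen' : (1 :: s).length = (1 :: r).length := by simpa using hlen
    -- in both words, the relative order of two letters is determined by which ones equal `1`
    have hone : ∀ i (h1 : i < (1 :: s).length) (h2 : i < (1 :: r).length),
        (1 :: s)[i] = 1 ↔ (1 :: r)[i] = 1 := by
      rintro (_ | i) h1 h2
      · simp
      · simp only [List.getElem_cons_succ]
        have := List.getElem_of_eq hr (i := i) (by simpa using h1)
        simpa using this
    have hposr : ∀ i (h2 : i < (1 :: r).length), 1 ≤ (1 :: r)[i] := fun i h2 =>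
      hpos _ (hsub.subset (List.getElem_mem h2))
    have hposs : ∀ i (h2 : i < (1 :: s).length), 1 ≤ (1 :: s)[i] := fun i h2 =>
      ht.1.pos (List.getElem_mem h2)
    have hlt : ∀ i j (hi : i < (1 :: s).length) (hj : j < (1 :: s).length)
        (hi' : i < (1 :: r).length) (hj' : j < (1 :: r).length), i < j →
        ((1 :: r)[i] = (1 :: r)[j] ↔ (1 :: s)[i] = (1 :: s)[j]) ∧
        ((1 :: r)[i] < (1 :: r)[j] ↔ (1 :: s)[i] < (1 :: s)[j]) := by
      intro i j hi hj hi' hj' hij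
      have a1 := List.pairwise_iff_getElem.1 hpr i j hi' hj' hij
      have a2 := List.pairwise_iff_getElem.1 hpt i j hi hj hij
      have a3 := hone i hi hi'
      have a4 := hone j hj hj'
      have a5 := hposr i hi'
      have a6 := hposs i hi
      omega
    obtain ⟨e, he⟩ := List.sublist_iff_exists_fin_orderEmbedding_get_eq.1 hsub
    refine ⟨fun j => e (Fin.cast hlen' j), fun x y hxy => e.strictMono (by simpa using hxy),
      fun i j => ?_⟩
    rw [← he, ← he]
    simp only [List.get_eq_getElem, Fin.val_cast]
    have hi' : (i : ℕ) < (1 :: r).length := hlen' ▸ i.2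
    have hj' : (j : ℕ) < (1 :: r).length := hlen' ▸ j.2
    rcases lt_trichotomy (i : ℕ) j with hij | hij | hij
    · exact hlt i j i.2 j.2 hi' hj' hij
    · obtain rfl := Fin.ext hij
      simp
    · have := hlt j i j.2 i.2 hj' hi' hij
      omega

theorem containsPattern_123_avoiders_iff {w t : List ℕ}
    (hw : IsRGF w ∧ w ≠ [] ∧ ¬ ContainsPattern w [1, 2, 3])
    (ht : IsRGF t ∧ t ≠ [] ∧ ¬ ContainsPattern t [1, 2, 3])
    (ht1 : t ≠ List.replicate t.length 1) :
    ContainsPattern w t ↔ (onesCode t).Sublist (onesCode w) := by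
  have hw2 := hw.1.avoids_123_iff.1 hw.2.2
  have ht2 := ht.1.avoids_123_iff.1 ht.2.2
  have hwpos := fun x => hw.1.pos (x := x)
  have htpos := fun x => ht.1.pos (x := x)
  have h2t : 2 ∈ t := by
    by_contra h2
    refine ht1 (List.eq_replicate_iff.2 ⟨rfl, fun x hx => ?_⟩)
    have := htpos x hx
    have := ht2 x hx
    have : x ≠ 2 := fun h => h2 (h ▸ hx)
    omega
  have h1t : 1 ∈ t := ht.1.mem_of_le h2t le_rfl (by norm_num)
  obtain ⟨v, rfl⟩ := hw.1.eq_one_cons hw.2.1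
  obtain ⟨s, rfl⟩ := ht.1.eq_one_cons ht.2.1
  simp only [onesCode, List.tail_cons]
  constructor
  · intro h
    obtain ⟨f, hf, hs⟩ := containsPattern_iff.1 h
    have h12 : f 1 < f 2 := hf h1t h2t (by norm_num)
    have h1 := hwpos _ (hs.subset (List.mem_map_of_mem h1t))
    have h2 := hw2 _ (hs.subset (List.mem_map_of_mem h2t))
    have hid : (1 :: s).map f = 1 :: s := by
      conv_rhs => rw [← List.map_id (1 :: s)]
      refine List.map_congr_left fun x hx => ?_
      have := htpos x hx
      have := ht2 x hx
      obtain rfl | rfl : x = 1 ∨ x = 2 := by omega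
      · simp; omega
      · simp; omega
    rw [hid, List.cons_sublist_cons] at hs
    exact hs.map _
  · intro h
    obtain ⟨r, hrv, hr⟩ := List.sublist_map_iff.1 h
    have hsr : s = r := by
      refine List.ext_getElem (by simpa using congrArg List.length hr) fun i h1 h2 => ?_
      have a1 := htpos _ (List.mem_cons_of_mem _ (List.getElem_mem h1))
      have a2 := ht2 _ (List.mem_cons_of_mem _ (List.getElem_mem h1))
      have hm := hrv.subset (List.getElem_mem h2)
      have a3 := hwpos _ (List.mem_cons_of_mem _ hm)
      have a4 := hw2 _ (List.mem_cons_of_mem _ hm)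
      have a5 : s[i] = 1 ↔ r[i] = 1 := by
        have := List.getElem_of_eq hr (i := i) (by simpa using h1)
        simpa using this
      omega
    subst hsr
    exact containsPattern_iff.2 ⟨id, strictMono_id.strictMonoOn _, by simpa using hrv⟩

/-- If the avoiders of `σ` are identified with binary words, and containment of `τ` with containment
of a subword, then the avoiders of `{σ, τ}` are counted by the compositions with fewer terms than
the size of `τ`. -/
theorem ncard_avoiders_of_onesCode {σ τ : List ℕ} {n : ℕ} (hn : 1 ≤ n) (hτ : τ ≠ [])
    (hcode : ∀ δ, ∃! w, (IsRGF w ∧ w ≠ [] ∧ ¬ ContainsPattern w σ) ∧ onesCode w = δ)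
    (hcont : ∀ w, IsRGF w ∧ w ≠ [] ∧ ¬ ContainsPattern w σ →
      (ContainsPattern w τ ↔ (onesCode τ).Sublist (onesCode w))) :
    (avoiders n {σ, τ}).ncard + dominatingCount (List.replicate τ.length 1) n = 2 ^ (n - 1) := by
  have hne : ∀ w : List ℕ, w.length = n → w ≠ [] := by
    rintro w hw rfl
    simp at hw
    omega
  have himage : onesCode '' avoiders n {σ, τ} =
      ((binaryWords (n - 1)).filter fun δ => ¬ (onesCode τ).Sublist δ : Finset (List Bool)) := by
    ext δ
    simp only [Set.mem_image, Finset.mem_coe, Finset.mem_filter, mem_binaryWords, avoiders,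
      Set.mem_ofPred_eq, Set.mem_insert_iff, Set.mem_singleton_iff, forall_eq_or_imp, forall_eq]
    constructor
    · rintro ⟨w, ⟨hw, hl, hσ, hav⟩, rfl⟩
      rw [hcont w ⟨hw, hne w hl, hσ⟩] at hav
      exact ⟨by simp [onesCode, hl], hav⟩
    · rintro ⟨hl, hav⟩
      obtain ⟨w, ⟨hw, rfl⟩, -⟩ := hcode δ
      rw [← hcont w hw] at hav
      have := List.length_pos_iff.2 hw.2.1
      simp only [onesCode, List.length_map, List.length_tail] at hl
      exact ⟨w, ⟨hw.1, by omega, hw.2.2, hav⟩, rfl⟩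
  have hinj : Set.InjOn onesCode (avoiders n {σ, τ}) := by
    rintro w ⟨hw, hl, hav⟩ w' ⟨hw', hl', hav'⟩ h
    exact (hcode (onesCode w')).unique ⟨⟨hw, hne w hl, hav σ (by simp)⟩, h⟩
      ⟨⟨hw', hne w' hl', hav' σ (by simp)⟩, rfl⟩
  have hlen : (onesCode τ).length + 1 = τ.length := by
    have := List.length_pos_iff.2 hτ
    simp only [onesCode, List.length_map, List.length_tail]
    omega
  have hsup := superwordCount_eq_dominatingCount (onesCode τ) (n - 1)
  rw [hlen, Nat.sub_add_cancel hn] at hsup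
  rw [← hinj.ncard_image, himage, Set.ncard_coe_finset, ← hsup, superwordCount, add_comm,
    Finset.card_filter_add_card_filter_not, card_binaryWords]

theorem ncard_avoiders_122 {τ : List ℕ} {n : ℕ} (hn : 1 ≤ n) (hτ : IsRGF τ) (hτ0 : τ ≠ [])
    (hav : ¬ ContainsPattern τ [1, 2, 2]) :
    (avoiders n {[1, 2, 2], τ}).ncard + dominatingCount (List.replicate τ.length 1) n =
      2 ^ (n - 1) :=
  ncard_avoiders_of_onesCode hn hτ0 existsUnique_onesCode_122 fun _ hw =>
    containsPattern_122_avoiders_iff hw ⟨hτ, hτ0, hav⟩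

theorem ncard_avoiders_123 {τ : List ℕ} {n : ℕ} (hn : 1 ≤ n) (hτ : IsRGF τ) (hτ0 : τ ≠ [])
    (hav : ¬ ContainsPattern τ [1, 2, 3]) (hτ1 : τ ≠ List.replicate τ.length 1) :
    (avoiders n {[1, 2, 3], τ}).ncard + dominatingCount (List.replicate τ.length 1) n =
      2 ^ (n - 1) :=
  ncard_avoiders_of_onesCode hn hτ0 existsUnique_onesCode_123 fun _ hw =>
    containsPattern_123_avoiders_iff hw ⟨hτ, hτ0, hav⟩ hτ1

/-- A word in two letters of length at least `2k - 1` has a letter of multiplicity `k`. -/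
theorem avoiders_123_replicate_one_eq_empty {k n : ℕ} (hn : 1 ≤ n) (hkn : 2 * k ≤ n + 1) :
    avoiders n {[1, 2, 3], List.replicate k 1} = ∅ := by
  refine Set.eq_empty_of_forall_notMem ?_
  rintro w ⟨hw, rfl, hav⟩
  have h2 := hw.avoids_123_iff.1 (hav _ (by simp))
  have hcount : w.count 1 + w.count 2 = w.length := by
    have h : ∀ x ∈ w, x = 1 ∨ x = 2 := fun x hx => by
      have := hw.pos hx
      have := h2 x hx
      omega
    clear hw hav h2 hn hkn
    induction w with
    | nil => rfl
    | cons x w ih =>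
      have := ih fun y hy => h y (List.mem_cons_of_mem _ hy)
      rcases h x (by simp) with rfl | rfl <;> simp <;> omega
  have hex : ∃ c, k ≤ w.count c := by
    by_contra hall
    push Not at hall
    have := hall 1
    have := hall 2
    omega
  obtain ⟨c, hc⟩ := hex
  refine hav (List.replicate k 1) (by simp) (containsPattern_iff.2 ⟨fun _ => c, ?_, ?_⟩)
  · intro x hx y hy hxy
    have := List.eq_of_mem_replicate hx
    have := List.eq_of_mem_replicate hy
    omega
  · rw [List.map_replicate]
    exact List.replicate_sublist_iff.2 hc

/-! ### The classification of pairs -/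

theorem isRGF_replicate_one (k : ℕ) : IsRGF (List.replicate k 1) := by
  induction k with
  | zero => exact isRGF_nil
  | succ k ih =>
    rw [List.replicate_succ', isRGF_append_singleton]
    exact ⟨ih, le_rfl, fun y hy hy1 => by omega⟩

/-- All pairs in the list of `P` have the number of avoiders given by the compositions that do not
dominate a composition with associated partition `P`. -/
theorem exists_composition_of_mem_describedClass {k : ℕ} (hk : 1 ≤ k) {P : Nat.Partition k}
    {T : Set (List ℕ)} (hT : T ∈ describedClass P) :
    ∃ a : Composition k, twoFreePartition a = P ∧
      ∀ n, 1 ≤ n → (avoiders n T).ncard + dominatingCount a.blocks n = 2 ^ (n - 1) := by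
  rcases hT with ⟨a, ha, rfl | rfl⟩ | ⟨hP, τ, hτ, rfl, hT⟩
  · exact ⟨a, ha, fun n _ => ncard_avoiders_121 n a⟩
  · exact ⟨a, ha, fun n _ => ncard_avoiders_112 n a⟩
  · have hτ0 : τ ≠ [] := List.length_pos_iff.1 hk
    refine ⟨Composition.ones τ.length, ?_, fun n hn => ?_⟩
    · refine Nat.Partition.ext ?_
      have hPr := Multiset.eq_replicate_card.2 hP
      have hcard : P.parts.card = τ.length := by
        have hsum := P.parts_sum
        rw [hPr] at hsum
        simpa using hsum
      rw [twoFreePartition_parts, hPr, hcard, Composition.ones_blocks, ← Multiset.coe_replicate,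
        Multiset.bind_congr (g := fun x => {x}), Multiset.bind_singleton, Multiset.map_id']
      intro x hx
      rw [if_neg]
      rintro rfl
      simpa using List.eq_of_mem_replicate (Multiset.mem_coe.1 hx)
    · rw [Composition.ones_blocks]
      rcases hT with ⟨hav, rfl⟩ | ⟨hav, hτ1, rfl⟩
      · exact ncard_avoiders_122 hn hτ hτ0 hav
      · exact ncard_avoiders_123 hn hτ hτ0 hav hτ1

theorem wilfEquiv_iff_domEquiv {k l : ℕ} {a : Composition k} {b : Composition l}
    {T R : Set (List ℕ)}
    (hT : ∀ n, 1 ≤ n → (avoiders n T).ncard + dominatingCount a.blocks n = 2 ^ (n - 1))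
    (hR : ∀ n, 1 ≤ n → (avoiders n R).ncard + dominatingCount b.blocks n = 2 ^ (n - 1)) :
    WilfEquiv T R ↔ DomEquiv a b := by
  rw [domEquiv_iff]
  refine forall₂_congr fun n hn => ?_
  have h1 := hT n hn
  have h2 := hR n hn
  omega

theorem wilfEquiv_iff_of_mem_describedClass {k : ℕ} (hk : 1 ≤ k) {P Q : Nat.Partition k}
    {T R : Set (List ℕ)} (hT : T ∈ describedClass P) (hR : R ∈ describedClass Q) :
    WilfEquiv T R ↔ P = Q := by
  obtain ⟨a, rfl, ha⟩ := exists_composition_of_mem_describedClass hk hT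
  obtain ⟨b, rfl, hb⟩ := exists_composition_of_mem_describedClass hk hR
  rw [wilfEquiv_iff_domEquiv ha hb, domEquiv_iff_twoFreePartition hk hk]
  exact ⟨Nat.Partition.ext, congrArg _⟩

/-- Some composition of `n` does not dominate `a`: the one with a single term if `a` has at least
two terms, and the one with all terms `1` if `a` has a single term, which is then at least `2`. -/
theorem dominatingCount_lt {k n : ℕ} (hk : 2 ≤ k) (hn : 1 ≤ n) (a : Composition k) :
    dominatingCount a.blocks n < 2 ^ (n - 1) := by
  classical
  rw [← card_compositionLists]
  have hsub : dominatingLists a.blocks n ⊆ compositionLists n := fun b hb =>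
    mem_compositionLists.2 (mem_dominatingLists.1 hb).1
  refine Finset.card_lt_card (hsub.ssubset_of_not_subset fun hall => ?_)
  have h1 := (mem_dominatingLists.1 (hall (mem_compositionLists.2
    ⟨by simp; omega, by simp⟩ : [n] ∈ compositionLists n))).2
  have h2 := (mem_dominatingLists.1 (hall (mem_compositionLists.2
    ⟨by simp, by simp⟩ : List.replicate n 1 ∈ compositionLists n))).2
  have hsum := a.blocks_sum
  generalize a.blocks = l at h1 h2 hsum
  obtain ⟨l₁, hl, hs⟩ := List.sublistForall₂_iff.1 h1
  have hlen : l.length ≤ 1 := hl.length_eq ▸ hs.length_le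
  obtain ⟨l₂, hl, hs⟩ := List.sublistForall₂_iff.1 h2
  match l, hlen with
  | [], _ => simp at hsum; omega
  | [x], _ =>
    obtain ⟨y, _, hxy, -, rfl⟩ := List.forall₂_cons_left_iff.1 hl
    have := List.eq_of_mem_replicate (hs.subset (List.mem_cons_self ..))
    simp at hsum
    omega

theorem not_wilfEquiv_123_replicate_one {k : ℕ} (hk : 2 ≤ k) {P : Nat.Partition k}
    {T : Set (List ℕ)} (hT : T ∈ describedClass P) :
    ¬ WilfEquiv T {[1, 2, 3], List.replicate k 1} := by
  intro h
  obtain ⟨a, -, ha⟩ := exists_composition_of_mem_describedClass (by omega) hT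
  have h1 := h (2 * k) (by omega)
  have h2 := ha (2 * k) (by omega)
  have h3 := dominatingCount_lt hk (show 1 ≤ 2 * k by omega) a
  rw [avoiders_123_replicate_one_eq_empty (by omega) (by omega), Set.ncard_empty] at h1
  omega

theorem eq_of_isRGF_of_length_three {σ : List ℕ} (hσ : IsRGF σ) (hl : σ.length = 3)
    (hc : 2 ≤ σ.toFinset.card) :
    σ = [1, 1, 2] ∨ σ = [1, 2, 1] ∨ σ = [1, 2, 2] ∨ σ = [1, 2, 3] := by
  match σ, hl with
  | [x, y, z], _ =>
    have h0 := hσ ⟨0, by simp⟩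
    have h1 := hσ ⟨1, by simp⟩
    have h2 := hσ ⟨2, by simp⟩
    simp at h0 h1 h2
    obtain rfl : x = 1 := by omega
    have h3 : y ≠ 1 ∨ z ≠ 1 := by
      by_contra! h
      obtain ⟨rfl, rfl⟩ := h
      simp at hc
    simp only [List.cons.injEq, and_true, true_and]
    omega

theorem mem_threePairs_cases {k : ℕ} {T : Set (List ℕ)} (hT : T ∈ threePairs k) :
    T = {[1, 2, 3], List.replicate k 1} ∨
      ∃ P : Nat.Partition k, IsTwoFree P ∧ T ∈ describedClass P := by
  obtain ⟨σ, τ, hσ, hσ3, hσ2, hτ, hτk, hav, rfl⟩ := hT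
  have hcomp : ∀ b ∈ compositionLists k, ∃ a : Composition k, a.blocks = b := fun b hb =>
    ⟨⟨b, fun hi => (mem_compositionLists.1 hb).1 _ hi, (mem_compositionLists.1 hb).2⟩, rfl⟩
  have hones : ∃ P : Nat.Partition k, IsTwoFree P ∧ ∀ x ∈ P.parts, x = 1 :=
    ⟨⟨Multiset.replicate k 1, fun hi => by simp [Multiset.eq_of_mem_replicate hi], by simp⟩,
      fun h => absurd (Multiset.eq_of_mem_replicate h) (by norm_num),
      fun x hx => Multiset.eq_of_mem_replicate hx⟩
  rcases eq_of_isRGF_of_length_three hσ hσ3 hσ2 with rfl | rfl | rfl | rfl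
  · have hmem : τ ∈ avoiders k {[1, 1, 2]} := ⟨hτ, hτk, by simpa using hav⟩
    rw [← image_tau112] at hmem
    obtain ⟨b, hb, rfl⟩ := hmem
    obtain ⟨a, rfl⟩ := hcomp b hb
    exact Or.inr ⟨_, isTwoFree_twoFreePartition a, Or.inl ⟨a, rfl, Or.inr rfl⟩⟩
  · have hmem : τ ∈ avoiders k {[1, 2, 1]} := ⟨hτ, hτk, by simpa using hav⟩
    rw [← image_tau121] at hmem
    obtain ⟨b, hb, rfl⟩ := hmem
    obtain ⟨a, rfl⟩ := hcomp b hb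
    exact Or.inr ⟨_, isTwoFree_twoFreePartition a, Or.inl ⟨a, rfl, Or.inl rfl⟩⟩
  · obtain ⟨P, hP, hP1⟩ := hones
    exact Or.inr ⟨P, hP, Or.inr ⟨hP1, τ, hτ, hτk, Or.inl ⟨hav, rfl⟩⟩⟩
  · by_cases h1 : τ = List.replicate k 1
    · exact Or.inl (by rw [h1])
    · obtain ⟨P, hP, hP1⟩ := hones
      exact Or.inr ⟨P, hP, Or.inr ⟨hP1, τ, hτ, hτk, Or.inr ⟨hav, h1, rfl⟩⟩⟩

theorem pair_121_mem_threePairs {k : ℕ} (a : Composition k) :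
    ({[1, 2, 1], tau121 a.blocks} : Set (List ℕ)) ∈ threePairs k := by
  have h : tau121 a.blocks ∈ avoiders k {[1, 2, 1]} := by
    rw [← image_tau121]
    exact ⟨a.blocks, mem_compositionLists.2 ⟨fun x hx => a.blocks_pos hx, a.blocks_sum⟩, rfl⟩
  have h2 : IsRGF [1, 2, 1] := by unfold IsRGF; decide
  exact ⟨_, _, h2, rfl, by decide, h.1, h.2.1, h.2.2 _ rfl, rfl⟩

theorem pair_123_mem_threePairs (k : ℕ) :
    ({[1, 2, 3], List.replicate k 1} : Set (List ℕ)) ∈ threePairs k := by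
  have h2 : IsRGF [1, 2, 3] := by unfold IsRGF; decide
  have hr := isRGF_replicate_one k
  refine ⟨_, _, h2, rfl, by decide, hr, by simp, ?_, rfl⟩
  rw [hr.avoids_123_iff]
  intro x hx
  rw [List.eq_of_mem_replicate hx]
  norm_num

theorem wilfEquiv_threePairs_iff {k : ℕ} (hk : 2 ≤ k) {T R : Set (List ℕ)}
    (hT : T ∈ threePairs k) (hR : R ∈ threePairs k) :
    WilfEquiv T R ↔ T = R ∨ ∃ P : Nat.Partition k, IsTwoFree P ∧
      T ∈ describedClass P ∧ R ∈ describedClass P := by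
  constructor
  · intro h
    rcases mem_threePairs_cases hT with rfl | ⟨P, hP, hTP⟩ <;>
      rcases mem_threePairs_cases hR with rfl | ⟨Q, hQ, hRQ⟩
    · exact Or.inl rfl
    · exact absurd (fun n hn => (h n hn).symm) (not_wilfEquiv_123_replicate_one hk hRQ)
    · exact absurd h (not_wilfEquiv_123_replicate_one hk hTP)
    · obtain rfl := (wilfEquiv_iff_of_mem_describedClass (by omega) hTP hRQ).1 h
      exact Or.inr ⟨P, hP, hTP, hRQ⟩
  · rintro (rfl | ⟨P, -, hTP, hRP⟩)
    · exact fun _ _ => rfl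
    · exact (wilfEquiv_iff_of_mem_describedClass (by omega) hTP hRP).2 rfl

/-! ### Counting the classes -/

/-- Removing one part `2` identifies the partitions of `k + 2` with a part `2` with the partitions
of `k`. -/
def partitionsWithTwoEquiv (k : ℕ) :
    {P : Nat.Partition (k + 2) // 2 ∈ P.parts} ≃ Nat.Partition k where
  toFun P := ⟨P.1.parts.erase 2, fun hi => P.1.parts_pos (Multiset.mem_of_mem_erase hi), by
    have h1 := congrArg Multiset.sum (Multiset.cons_erase P.2)
    rw [Multiset.sum_cons, P.1.parts_sum] at h1
    omega⟩
  invFun Q := ⟨⟨2 ::ₘ Q.parts, fun {i} hi => by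
      rcases Multiset.mem_cons.1 hi with rfl | hi
      · norm_num
      · exact Q.parts_pos hi, by rw [Multiset.sum_cons, Q.parts_sum, add_comm]⟩,
    Multiset.mem_cons_self _ _⟩
  left_inv P := Subtype.ext (Nat.Partition.ext (Multiset.cons_erase P.2))
  right_inv Q := Nat.Partition.ext (Multiset.erase_cons_head _ _)

theorem card_isTwoFree (k : ℕ) :
    (Nat.card {P : Nat.Partition k // IsTwoFree P} : ℤ) =
      partitionNumber k - partitionNumber ((k : ℤ) - 2) := by
  classical
  have hk : partitionNumber k = Fintype.card (Nat.Partition k) := by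
    rw [partitionNumber, if_pos (Int.natCast_nonneg k), Int.toNat_natCast]
  have hcompl : Nat.card {P : Nat.Partition k // IsTwoFree P} +
      Nat.card {P : Nat.Partition k // 2 ∈ P.parts} = Fintype.card (Nat.Partition k) := by
    have h : Nat.card {P : Nat.Partition k // IsTwoFree P} =
        Nat.card {P : Nat.Partition k // ¬ 2 ∈ P.parts} := rfl
    rw [h, Nat.card_eq_fintype_card, Nat.card_eq_fintype_card, add_comm,
      Fintype.card_subtype_compl]
    exact Nat.add_sub_cancel' (Fintype.card_subtype_le _)
  have htwo : (Nat.card {P : Nat.Partition k // 2 ∈ P.parts} : ℤ) =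
      partitionNumber ((k : ℤ) - 2) := by
    rcases Nat.lt_or_ge k 2 with h | h
    · rw [partitionNumber, if_neg (by omega)]
      have : IsEmpty {P : Nat.Partition k // 2 ∈ P.parts} := ⟨fun P => by
        have h1 := Multiset.le_sum_of_mem P.2
        rw [P.1.parts_sum] at h1
        omega⟩
      simp
    · obtain ⟨m, rfl⟩ := Nat.exists_eq_add_of_le' h
      rw [Nat.card_congr (partitionsWithTwoEquiv m), Nat.card_eq_fintype_card, partitionNumber,
        if_pos (by omega)]
      norm_num
  omega

theorem domClassCount_eq (k : ℕ) :
    domClassCount k = Nat.card {P : Nat.Partition k // IsTwoFree P} := by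
  have hiff : ∀ a a' : Composition k, DomEquiv a a' ↔ twoFreePartition a = twoFreePartition a' := by
    intro a a'
    rcases Nat.eq_zero_or_pos k with rfl | hk
    · obtain rfl : a = a' := Fintype.card_le_one_iff.1 (composition_card 0).le a a'
      exact ⟨fun _ => rfl, fun _ _ _ => rfl⟩
    · rw [domEquiv_iff_twoFreePartition hk hk]
      exact ⟨Nat.Partition.ext, congrArg _⟩
  refine Nat.card_eq_of_bijective (Quotient.lift (s := domSetoid k)
    (fun a => (⟨twoFreePartition a, isTwoFree_twoFreePartition a⟩ :
      {P : Nat.Partition k // IsTwoFree P}))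
    fun a a' h => Subtype.ext ((hiff a a').1 h)) ⟨?_, ?_⟩
  · rintro ⟨a⟩ ⟨a'⟩ h
    exact Quotient.sound (s := domSetoid k) ((hiff a a').2 (congrArg Subtype.val h))
  · rintro ⟨P, hP⟩
    obtain ⟨a, rfl⟩ := exists_twoFreePartition_eq hP
    exact ⟨Quotient.mk (domSetoid k) a, rfl⟩

/-- Apart from the class of `{123, 1^k}`, the classes correspond to the `2`-free partitions. -/
theorem wilfClassCount_eq {k : ℕ} (hk : 2 ≤ k) :
    wilfClassCount k = Nat.card {P : Nat.Partition k // IsTwoFree P} + 1 := by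
  choose a ha using fun P : {P : Nat.Partition k // IsTwoFree P} => exists_twoFreePartition_eq P.2
  have hmem : ∀ P, ({[1, 2, 1], tau121 (a P).blocks} : Set (List ℕ)) ∈ describedClass P.1 :=
    fun P => Or.inl ⟨a P, ha P, Or.inl rfl⟩
  let rep : Option {P : Nat.Partition k // IsTwoFree P} → threePairs k := fun o =>
    o.elim ⟨_, pair_123_mem_threePairs k⟩ fun P => ⟨_, pair_121_mem_threePairs (a P)⟩
  rw [← Finite.card_option, wilfClassCount]
  refine (Nat.card_eq_of_bijective (fun o => Quotient.mk (wilfSetoid k) (rep o)) ⟨?_, ?_⟩).symm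
  · intro o o' h
    have hw : WilfEquiv (rep o).1 (rep o').1 := Quotient.exact h
    rcases o with _ | P <;> rcases o' with _ | Q
    · rfl
    · exact absurd (fun n hn => (hw n hn).symm) (not_wilfEquiv_123_replicate_one hk (hmem Q))
    · exact absurd hw (not_wilfEquiv_123_replicate_one hk (hmem P))
    · exact congrArg some (Subtype.ext
        ((wilfEquiv_iff_of_mem_describedClass (by omega) (hmem P) (hmem Q)).1 hw))
  · rintro ⟨⟨T, hT⟩⟩
    rcases mem_threePairs_cases hT with rfl | ⟨P, hP, hTP⟩
    · exact ⟨none, rfl⟩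
    · refine ⟨some ⟨P, hP⟩, Quotient.sound (s := wilfSetoid k) ?_⟩
      exact (wilfEquiv_iff_of_mem_describedClass (by omega) (hmem ⟨P, hP⟩) hTP).2 rfl

theorem mainTheorem2 :
    -- the number of dominating equivalence classes
    (∀ k : ℕ,
      (domClassCount k : ℤ) = partitionNumber k - partitionNumber ((k : ℤ) - 2) ∧
      domClassCount k = Nat.card {P : Nat.Partition k // IsTwoFree P}) ∧
    -- the number of Wilf-equivalence classes
    (∀ k : ℕ, 2 ≤ k →
      (wilfClassCount k : ℤ) = partitionNumber k - partitionNumber ((k : ℤ) - 2) + 1) ∧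
    -- there are no further Wilf-equivalences among the pairs with first pattern `112`,
    -- and no two distinct `2`-free partitions are dominating equivalent
    (∀ (k l : ℕ), 1 ≤ k → 1 ≤ l → ∀ (a : Composition k) (a' : Composition l),
      (DomEquiv a a' ↔ (twoFreePartition a).parts = (twoFreePartition a').parts) ∧
      (WilfEquiv {[1, 1, 2], tau112 a.blocks} {[1, 1, 2], tau112 a'.blocks} ↔
        (twoFreePartition a).parts = (twoFreePartition a').parts)) ∧
    -- there are no further Wilf-equivalences among all `(3,k)`-pairs
    (∀ k : ℕ, 2 ≤ k → ∀ T ∈ threePairs k, ∀ R ∈ threePairs k,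
      (WilfEquiv T R ↔
        T = R ∨ ∃ P : Nat.Partition k, IsTwoFree P ∧
          T ∈ describedClass P ∧ R ∈ describedClass P)) := by
  refine ⟨fun k => ⟨?_, domClassCount_eq k⟩, fun k hk => ?_, fun k l hk hl a a' => ⟨?_, ?_⟩,
    fun k hk T hT R hR => wilfEquiv_threePairs_iff hk hT hR⟩
  · rw [domClassCount_eq, card_isTwoFree]
  · rw [wilfClassCount_eq hk, Nat.cast_add, card_isTwoFree, Nat.cast_one]
  · exact domEquiv_iff_twoFreePartition hk hl a a'
  · rw [wilfEquiv_iff_domEquiv (fun n _ => ncard_avoiders_112 n a)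
      fun n _ => ncard_avoiders_112 n a']
    exact domEquiv_iff_twoFreePartition hk hl a a'
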